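/- Write $\log=\log_2$. A state on a finite-dimensional Hilbert space is sub-normalized if it is positive semi-definite with trace in $(0,1]$, normalized if its trace is $1$. For sub-normalized $\rho,\tau$ let $P(\rho,\tau)=\sqrt{1-\bar F(\rho,\tau)^2}$ with $\bar F(\rho,\tau)=\mathrm{tr}|\sqrt\rho\sqrt\tau|+\sqrt{(1-\mathrm{tr}\rho)(1-\mathrm{tr}\tau)}$ be the purified distance. Let $H_{\min}(A|B)_\rho=\sup\{\lambda\in\mathbb R:\rho_{AB}\le 2^{-\lambda}\,1_A\otimes\sigma_B\text{ for some normalized }\sigma_B\}$, and let $H^\varepsilon_{\min}(A|B)_\rho\in(-\infty,\infty]$ be the supremum of $H_{\min}(A|B)_{\tilde\rho}$ over all sub-normalized $\tilde\rho$ with $P(\rho,\tilde\rho)\le\varepsilon$ (with $2^{-\infty}=0$ below). Let $d(A|B)_\rho=\min_\sigma\frac12\|\rho_{AB}-\frac{1_A}{\dim A}\otimes\sigma_B\|_1$, the minimum being over positive semi-definite $\sigma_B$ with $\mathrm{tr}\,\sigma_B=\mathrm{tr}\,\rho_B$. Theorem. Let $n,\ell\ge 1$ be integers and $\varepsilon>0$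 a real number, and suppose that $k:=\lfloor \ell+\log(n/\ell)+\log(1/\varepsilon^2)-1\rfloor\ge 0$. There is a family of hash functions $f_\alpha:\{0,1\}^n\to\{0,1\}^\ell$, indexed by seeds $\alpha$ from a finite set $F$, with seed length $$s=\log|F|=2\lfloor \ell+\log(n/\ell)+\log(1/\varepsilon^2)-1\rfloor ,$$ such that for every finite-dimensional quantum system $E$ and every (possibly sub-normalized) classical-quantum state $\rho_{XE}=\sum_{x\in\{0,1\}^n}|x\rangle\langle x|\otimes\rho_E^{[x]}$, the state $$\rho_{FZE}=\sum_{\alpha,z}\tfrac1{|F|}|\alpha\rangle\langle\alpha|\otimes|z\rangle\langle z|\otimes\sum_{x:f_\alpha(x)=z}\rho_E^{[x]}$$ obtained by hashing $X$ with a uniformly random, published seed satisfies $$e:=d(Z|FE)_\rho\le 3\varepsilon+\tfrac12\sqrt{2^{\,\ell-H^\varepsilon_{\min}(X|E)_\rho+\log(2/\varepsilon^2+1)}} .$$ Moreover, if $k\ge1$, the following explicit family has both properties, for every choice of a basis of $\mathrm{GF}(2^k)$ over $\mathrm{GF}(2)$ through which $k$-bit strings are read as elements of $\mathrm{GF}(2^k)$.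 The seed is a pair $(\alpha,\beta)$ of $k$-bit strings. The $n$-bit input is split into $r=\lceil n/k\rceil$ blocks $x_1,\dots,x_r$ of $k$ bits (the last one padded with zeros), $y=\sum_{i=1}^r x_i\alpha^{r-i}\in\mathrm{GF}(2^k)$ is computed, and the output is $y\cdot\beta \bmod 2^\ell$, i.e. the $\ell$ lowest bits of the product $y\cdot\beta$ in $\mathrm{GF}(2^k)$ (with zeros for the bits beyond the $k$-th if $\ell>k$). -/

import Mathlib

open scoped ENNReal

universe u

noncomputable section QuantumStates

open scoped ComplexOrder MatrixOrder Kronecker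

/-- The trace norm `‖A‖₁ = tr |A|`, where `|A| = √(A† A)`. -/
def traceNorm {H : Type*} [Fintype H] [DecidableEq H] (A : Matrix H H ℂ) : ℝ :=
  (CFC.sqrt (A.conjTranspose * A)).trace.re

/-- Normalized states: positive semi-definite operators of trace one. -/
def IsNormalizedState {H : Type*} [Fintype H] (ρ : Matrix H H ℂ) : Prop :=
  ρ.PosSemidef ∧ ρ.trace = 1

/-- Sub-normalized states: positive semi-definite operators with trace in `(0, 1]`. -/
def IsSubnormalizedState {H : Type*} [Fintype H] (ρ : Matrix H H ℂ) : Prop :=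
  ρ.PosSemidef ∧ 0 < ρ.trace.re ∧ ρ.trace.re ≤ 1

/-- The generalized fidelity `tr |√ρ √τ| + √((1 - tr ρ) (1 - tr τ))`. -/
def genFidelity {H : Type*} [Fintype H] [DecidableEq H] (ρ τ : Matrix H H ℂ) : ℝ :=
  traceNorm (CFC.sqrt ρ * CFC.sqrt τ) + √((1 - ρ.trace.re) * (1 - τ.trace.re))

/-- The purified distance. -/
def purifiedDist {H : Type*} [Fintype H] [DecidableEq H] (ρ τ : Matrix H H ℂ) : ℝ :=
  √(1 - genFidelity ρ τ ^ 2)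

/-- The ball of sub-normalized states around `ρ` in purified distance. -/
def epsBall {H : Type*} [Fintype H] [DecidableEq H] (ε : ℝ) (ρ : Matrix H H ℂ) :
    Set (Matrix H H ℂ) :=
  {τ | IsSubnormalizedState τ ∧ purifiedDist ρ τ ≤ ε}

/-- The conditional min-entropy `H_min(A|B)_ρ`: the supremum of all real `l` such that
`ρ ≤ 2^(-l) 1_A ⊗ σ` for some normalized state `σ` on `B`. -/
def minEntropy {A B : Type*} [Fintype A] [DecidableEq A] [Fintype B] [DecidableEq B]
    (ρ : Matrix (A × B) (A × B) ℂ) : EReal :=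
  ⨆ (σ : Matrix B B ℂ) (_ : IsNormalizedState σ) (l : ℝ)
    (_ : ρ ≤ ((2 : ℝ) ^ (-l)) • ((1 : Matrix A A ℂ) ⊗ₖ σ)), (l : EReal)

/-- The smooth conditional min-entropy `H_min^ε(A|B)_ρ`. It is `⊤` exactly if the min-entropy is
unbounded on the ball, which needs `ε ≥ √(tr ρ)`. -/
def smoothMinEntropy {A B : Type*} [Fintype A] [DecidableEq A] [Fintype B] [DecidableEq B]
    (ε : ℝ) (ρ : Matrix (A × B) (A × B) ℂ) : EReal :=
  ⨆ τ ∈ epsBall ε ρ, minEntropy τ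

/-- The marginal `ρ_B = tr_A ρ_AB`. -/
def partialTraceA {A B : Type*} [Fintype A] (ρ : Matrix (A × B) (A × B) ℂ) : Matrix B B ℂ :=
  Matrix.of fun b b' => ∑ a, ρ (a, b) (a, b')

/-- The distance from uniform of `A` conditioned on `B`: the minimum of
`½ ‖ρ_AB - ω_A ⊗ σ_B‖₁` over all positive `σ_B` with `tr σ_B = tr ρ_B`, where
`ω_A = 1_A / dim A`. -/
def distUniform {A B : Type*} [Fintype A] [DecidableEq A] [Fintype B] [DecidableEq B]
    (ρ : Matrix (A × B) (A × B) ℂ) : ℝ :=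
  ⨅ σ : {σ : Matrix B B ℂ // σ.PosSemidef ∧ σ.trace = (partialTraceA ρ).trace},
    1 / 2 * traceNorm (ρ - ((Fintype.card A : ℂ)⁻¹ • (1 : Matrix A A ℂ)) ⊗ₖ σ.1)

/-- The classical-quantum state `ρ_XE = ∑ x, |x⟩⟨x| ⊗ ρ^[x]`. -/
def cqState {X E : Type*} [Fintype X] [DecidableEq X]
    (ρ : X → Matrix E E ℂ) : Matrix (X × E) (X × E) ℂ :=
  ∑ x, Matrix.single x x (1 : ℂ) ⊗ₖ ρ x

/-- The state of (hash value, seed, side information) after a hash function, chosen by a uniform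
seed `s`, has been applied to `X`:
`∑ z, ∑ s, |z⟩⟨z| ⊗ (1 / |S|) |s⟩⟨s| ⊗ ρ^[s,z]` with `ρ^[s,z] = ∑ x with f s x = z, ρ^[x]`. -/
def hashedState {S X Z E : Type*} [Fintype S] [DecidableEq S] [Fintype X] [Fintype Z]
    [DecidableEq Z] (f : S → X → Z) (ρ : X → Matrix E E ℂ) :
    Matrix (Z × (S × E)) (Z × (S × E)) ℂ :=
  ∑ z, ∑ s, Matrix.single z z (1 : ℂ) ⊗ₖ
    (Matrix.single s s ((Fintype.card S : ℂ)⁻¹) ⊗ₖ ∑ x with f s x = z, ρ x)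

/-- The power `2^x` of an extended real, with `2^⊥ = 0` and `2^⊤ = ∞`. -/
def twoPow (x : EReal) : ℝ≥0∞ :=
  EReal.exp ((Real.log 2 : EReal) * x)

end QuantumStates

noncomputable section Hashing

/-- Bit strings of length `n`. -/
abbrev BitString (n : ℕ) : Type := Fin n → ZMod 2

/-- The seed length `log₂ |F|` of a family `f` of functions indexed by seeds. -/
def seedLength {S X Z : Type*} [Fintype S] (_f : S → X → Z) : ℝ :=
  Real.logb 2 (Fintype.card S)

/-- For every finite-dimensional `E` and every (sub-normalized) classical-quantum state `ρ_XE`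
with `X` an `n`-bit string, the hash value `Z` of `ℓ` bits satisfies
`d(Z|FE)_ρ ≤ 3 ε + ½ √(2^(ℓ - H_min^ε(X|E)_ρ + log₂(2/ε² + 1)))`. -/
def SatisfiesErrorBound {S : Type*} [Fintype S] [DecidableEq S] {n ℓ : ℕ}
    (f : S → BitString n → BitString ℓ) (ε : ℝ) : Prop :=
  ∀ (E : Type u) [Fintype E] [DecidableEq E] (ρ : BitString n → Matrix E E ℂ),
    IsSubnormalizedState (cqState ρ) →
    ENNReal.ofReal (distUniform (hashedState f ρ)) ≤
      ENNReal.ofReal (3 * ε) + 1 / 2 *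
        twoPow ((ℓ : EReal) - smoothMinEntropy ε (cqState ρ)
          + (Real.logb 2 (2 / ε ^ 2 + 1) : EReal)) ^ (1 / 2 : ℝ)

/-- The polynomial hash function `(x₁, …, x_r) ↦ ∑ i, x_i α^(r - i)` over a field
(here the indices start at `0`). -/
def polyHash {K : Type*} [Field K] {r : ℕ} (α : K) (x : Fin r → K) : K :=
  ∑ i : Fin r, x i * α ^ (r - 1 - (i : ℕ))

/-- Block `i` (of `k` bits) of an `n`-bit string, padded with zeros behind the last bit. -/
def bitBlock {n : ℕ} (k : ℕ) (x : BitString n) (i : ℕ) : BitString k :=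
  fun j => if h : i * k + j < n then x ⟨i * k + j, h⟩ else 0

/-- Reduction modulo `2^ℓ`: the `ℓ` lowest bits (bit `0` is the lowest one). -/
def lowBits {k : ℕ} (ℓ : ℕ) (x : BitString k) : BitString ℓ :=
  fun j => if h : (j : ℕ) < k then x ⟨j, h⟩ else 0

/-- Polynomial hashing of `n`-bit strings, read as `⌈n/k⌉` blocks of `k` bits, to `k` bits with a
seed of `k` bits. The field elements of `GF(2^k)` are written as `k`-bit strings through a basis
over `GF(2)`. -/
def polyHashBits {k : ℕ} (b : Module.Basis (Fin k) (ZMod 2) (GaloisField 2 k)) (n : ℕ)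
    (α : BitString k) (x : BitString n) : BitString k :=
  b.equivFun (polyHash (r := n ⌈/⌉ k) (b.equivFun.symm α)
    fun i => b.equivFun.symm (bitBlock k x i))

/-- Multiplicative hashing `x ↦ x · α mod 2^ℓ`, with multiplication in `GF(2^k)`. -/
def multHashBits {k : ℕ} (b : Module.Basis (Fin k) (ZMod 2) (GaloisField 2 k)) (ℓ : ℕ)
    (α : BitString k) (x : BitString k) : BitString ℓ :=
  lowBits ℓ (b.equivFun (b.equivFun.symm x * b.equivFun.symm α))

/-- Polynomial hashing over `GF(2^k)` followed by multiplicative hashing, with independent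
`k`-bit seeds. -/
def composedHash {k : ℕ} (b : Module.Basis (Fin k) (ZMod 2) (GaloisField 2 k)) (n ℓ : ℕ)
    (s : BitString k × BitString k) : BitString n → BitString ℓ :=
  multHashBits b ℓ s.2 ∘ polyHashBits b n s.1

end Hashing

/-!
The error bound is an instance of the leftover hash lemma for almost two-universal families against
quantum side information, and the explicit family is almost two-universal.

*Collisions.* Distinct inputs `x`, `x'` have the same polynomial hash only if `α` is a root of a
nonzero polynomial of degree less than `r`; otherwise multiplicative hashing separates them up to
probability `2 ^ (-ℓ)`. The choice of `k` makes `2 ^ ℓ (r - 1) / 2 ^ k ≤ 4 ε²` once `ℓ ≤ k`, so the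
collision probability is at most `2 ^ (-ℓ) (1 + 4 ε²)` (`composedHash_collision_bound`). If
`1 ≤ 3 ε` or `n ≤ ℓ` the bound holds for every function, because the distance from uniform is at
most `tr ρ` (`satisfiesErrorBound_of_trivial`); in all other cases `ℓ ≤ k`.

*Hashing.* Let `τ` be classical on `X`, with blocks `τ x ≤ μ σ` and marginal `w = ∑ x, τ x`. For a
positive definite weight `ω` of trace at most one, Cauchy–Schwarz bounds the trace norm `‖M‖₁` by
the square root of `⟨M, M⟩`, where `⟨a, b⟩ = tr (ω ^ (-1/2) a ω ^ (-1/2) b)`. This form is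
nonnegative on pairs of positive operators, so expanding the second moment of the deviation of the
hash from uniform and inserting the collision bound gives
`2 ^ ℓ ∑ x, ⟨τ x, τ x⟩ + 4 ε² ⟨w, w⟩` (`sum_sq_hash_deviation_le`). A weight that mixes `σ`, `w` and
the maximally mixed state dominates multiples of both `τ x` and `w`, and makes this at most
`4 · 2 ^ ℓ μ + 8 ε²` (`leftover_hash`). Mixing `w` into the weight takes the place of a second
smoothing step towards a state whose min-entropy is measured relative to its own marginal.

*Smoothing.* The distance from uniform changes by at most the generalized trace distance between
`ρ` and the smoothing state, hence by at most their purified distance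
(`generalizedTraceDist_le_purifiedDist`). A smoothing state that is not classical on `X` is pinched,
which preserves operator inequalities `τ ≤ μ (1 ⊗ σ)` and does not increase trace distances
(`distUniform_hashedState_le_of_mem_epsBall`). All facts on the trace norm come from the polar
decomposition, through `‖M‖₁ = max Re tr (U M)` over unitaries `U`.
-/

open scoped ComplexOrder MatrixOrder Kronecker

/-! ### The trace norm and the purified distance -/

section TraceNorm

open Matrix

variable {H : Type*} [Fintype H] [DecidableEq H]

theorem re_trace_conjTranspose_mul_self {H K : Type*} [Fintype H] [Fintype K] (X : Matrix H K ℂ) :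
    (Xᴴ * X).trace.re = ∑ p : K × H, ‖X p.2 p.1‖ ^ 2 := by
  simp only [Matrix.trace, Matrix.diag, Matrix.mul_apply, Matrix.conjTranspose_apply,
    Complex.re_sum, Fintype.sum_prod_type]
  refine Finset.sum_congr rfl fun i _ => Finset.sum_congr rfl fun j _ => ?_
  rw [← Complex.normSq_eq_norm_sq]
  simp [Complex.normSq_apply]

/-- The Cauchy–Schwarz inequality for the Hilbert–Schmidt inner product. -/
theorem re_trace_conjTranspose_mul_le {H K : Type*} [Fintype H] [Fintype K]
    (X Y : Matrix H K ℂ) :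
    (Xᴴ * Y).trace.re ≤ √((Xᴴ * X).trace.re) * √((Yᴴ * Y).trace.re) := by
  rw [re_trace_conjTranspose_mul_self, re_trace_conjTranspose_mul_self]
  refine le_trans ?_ (Real.sum_mul_le_sqrt_mul_sqrt _ _ _)
  simp only [Matrix.trace, Matrix.diag, Matrix.mul_apply, Matrix.conjTranspose_apply,
    Complex.re_sum, Fintype.sum_prod_type]
  refine Finset.sum_le_sum fun i _ => Finset.sum_le_sum fun j _ => ?_
  refine (Complex.re_le_norm _).trans ?_
  simp

theorem re_trace_conjTranspose_mul_self_nonneg {H K : Type*} [Fintype H]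
    [Fintype K] (X : Matrix H K ℂ) :
    0 ≤ (Xᴴ * X).trace.re := by
  rw [re_trace_conjTranspose_mul_self]
  positivity

theorem sqrt_posSemidef (A : Matrix H H ℂ) : (CFC.sqrt A).PosSemidef :=
  (CFC.sqrt_nonneg A).posSemidef

theorem sqrt_mul_sqrt {A : Matrix H H ℂ} (hA : A.PosSemidef) : CFC.sqrt A * CFC.sqrt A = A :=
  CFC.sqrt_mul_sqrt_self A hA.nonneg

/-- Square matrices with the same Gram matrix differ by a unitary on the left: `P v ↦ M v` is a
well-defined isometry on the range of `P`, and extends to the whole space. -/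
theorem exists_isometry_mul_eq {P M : Matrix H H ℂ} (h : Pᴴ * P = Mᴴ * M) :
    ∃ W : Matrix H H ℂ, Wᴴ * W = 1 ∧ W * P = M := by
  set p := Matrix.toEuclideanLin P with hp
  set q := Matrix.toEuclideanLin M with hq
  have hnorm : ∀ v, ‖p v‖ = ‖q v‖ := by
    intro v
    have key : ∀ N : Matrix H H ℂ, inner ℂ (Matrix.toEuclideanLin N v) (Matrix.toEuclideanLin N v)
        = inner ℂ v (Matrix.toEuclideanLin (Nᴴ * N) v) := by
      intro N
      rw [← LinearMap.adjoint_inner_right, ← Matrix.toEuclideanLin_conjTranspose_eq_adjoint]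
      simp [Matrix.toLpLin_apply, Matrix.mulVec_mulVec]
    have h1 : inner ℂ (p v) (p v) = inner ℂ (q v) (q v) := by
      rw [hp, hq, key, key, h]
    rw [inner_self_eq_norm_sq_to_K, inner_self_eq_norm_sq_to_K] at h1
    have h2 : ‖p v‖ ^ 2 = ‖q v‖ ^ 2 := by exact_mod_cast h1
    exact (sq_eq_sq₀ (norm_nonneg _) (norm_nonneg _)).1 h2
  have hker : LinearMap.ker p ≤ LinearMap.ker q := by
    intro v hv
    rw [LinearMap.mem_ker] at hv ⊢
    rw [← norm_eq_zero, ← hnorm, hv, norm_zero]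
  let L₀ : LinearMap.range p →ₗ[ℂ] EuclideanSpace ℂ H :=
    (LinearMap.ker p).liftQ q hker ∘ₗ p.quotKerEquivRange.symm.toLinearMap
  have hL₀ : ∀ v, L₀ ⟨p v, LinearMap.mem_range_self p v⟩ = q v := by
    intro v
    have : p.quotKerEquivRange.symm ⟨p v, LinearMap.mem_range_self p v⟩
        = (LinearMap.ker p).mkQ v := by
      rw [LinearEquiv.symm_apply_eq]; rfl
    simp [L₀, this]
  let L : LinearMap.range p →ₗᵢ[ℂ] EuclideanSpace ℂ H :=
    ⟨L₀, by
      rintro ⟨_, v, rfl⟩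
      rw [hL₀ v, ← hnorm]
      rfl⟩
  let T := L.extend
  have hT : ∀ v, T (p v) = q v := fun v => by
    have := L.extend_apply ⟨p v, LinearMap.mem_range_self p v⟩
    exact this.trans (hL₀ v)
  refine ⟨Matrix.toEuclideanLin.symm T.toLinearMap, ?_, ?_⟩
  · apply Matrix.toEuclideanLin.injective
    ext1 v
    refine ext_inner_left ℂ fun w => ?_
    have e1 : Matrix.toEuclideanLin ((Matrix.toEuclideanLin.symm T.toLinearMap)ᴴ *
        Matrix.toEuclideanLin.symm T.toLinearMap) v =
        LinearMap.adjoint T.toLinearMap (T v) := by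
      conv_rhs => rw [← (Matrix.toEuclideanLin.apply_symm_apply T.toLinearMap),
        ← Matrix.toEuclideanLin_conjTranspose_eq_adjoint]
      have : T v = Matrix.toEuclideanLin (Matrix.toEuclideanLin.symm T.toLinearMap) v := by
        rw [LinearEquiv.apply_symm_apply]; rfl
      rw [this]
      simp [Matrix.toLpLin_apply]
    rw [e1, LinearMap.adjoint_inner_right]
    simp
  · apply Matrix.toEuclideanLin.injective
    ext1 v
    have : Matrix.toEuclideanLin (Matrix.toEuclideanLin.symm T.toLinearMap * P) v =
        Matrix.toEuclideanLin (Matrix.toEuclideanLin.symm T.toLinearMap) (p v) := by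
      simp [hp, Matrix.toLpLin_apply]
    rw [this, LinearEquiv.apply_symm_apply]
    exact hT v

theorem sqrt_mul_sqrt_conjTranspose_mul_self (M : Matrix H H ℂ) :
    CFC.sqrt (Mᴴ * M) * CFC.sqrt (Mᴴ * M) = Mᴴ * M :=
  sqrt_mul_sqrt (posSemidef_conjTranspose_mul_self M)

/-- The polar decomposition `M = W |M|` of a square matrix, with `W` unitary. -/
theorem exists_polar_decomposition (M : Matrix H H ℂ) :
    ∃ W : Matrix H H ℂ, Wᴴ * W = 1 ∧ W * CFC.sqrt (Mᴴ * M) = M := by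
  apply exists_isometry_mul_eq
  rw [(sqrt_posSemidef _).isHermitian.eq, sqrt_mul_sqrt_conjTranspose_mul_self]

theorem exists_unitary_mul_eq_sqrt (M : Matrix H H ℂ) :
    ∃ U : Matrix H H ℂ, Uᴴ * U = 1 ∧ U * M = CFC.sqrt (Mᴴ * M) := by
  obtain ⟨W, hW, hM⟩ := exists_polar_decomposition M
  refine ⟨Wᴴ, ?_, ?_⟩
  · rw [conjTranspose_conjTranspose]
    exact mul_eq_one_comm.1 hW
  · conv_lhs => rw [← hM]
    rw [← Matrix.mul_assoc, hW, Matrix.one_mul]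

theorem exists_unitary_re_trace_eq_traceNorm (M : Matrix H H ℂ) :
    ∃ U : Matrix H H ℂ, Uᴴ * U = 1 ∧ (U * M).trace.re = traceNorm M := by
  obtain ⟨U, hU, h⟩ := exists_unitary_mul_eq_sqrt M
  exact ⟨U, hU, by rw [h, traceNorm]⟩

/-- Together with `exists_unitary_re_trace_eq_traceNorm`, this says that the trace norm is the
maximum of `Re tr (U M)` over all unitaries `U`. -/
theorem re_trace_mul_le_traceNorm {U : Matrix H H ℂ} (hU : Uᴴ * U = 1) (M : Matrix H H ℂ) :
    (U * M).trace.re ≤ traceNorm M := by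
  obtain ⟨W, hW, hM⟩ := exists_polar_decomposition M
  set P := CFC.sqrt (Mᴴ * M) with hP
  have hPpos : P.PosSemidef := sqrt_posSemidef _
  set Q := CFC.sqrt P
  have hQ : Q * Q = P := sqrt_mul_sqrt hPpos
  have hQh : Qᴴ = Q := (sqrt_posSemidef P).isHermitian.eq
  have e1 : (U * M).trace = (Qᴴ * (U * W * Q)).trace := by
    rw [Matrix.trace_mul_comm Qᴴ, hQh, Matrix.mul_assoc, Matrix.mul_assoc, hQ, hM]
  have e2 : (U * W * Q)ᴴ * (U * W * Q) = P := by
    simp only [conjTranspose_mul]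
    calc Qᴴ * (Wᴴ * Uᴴ) * (U * W * Q) = Qᴴ * (Wᴴ * (Uᴴ * U) * W) * Q := by
          simp only [Matrix.mul_assoc]
      _ = P := by rw [hU, Matrix.mul_one, hW, Matrix.mul_one, hQh, hQ]
  have h := re_trace_conjTranspose_mul_le Q (U * W * Q)
  rw [← e1, e2, hQh, hQ, Real.mul_self_sqrt] at h
  · exact h
  · exact (Complex.nonneg_iff.1 hPpos.trace_nonneg).1

theorem traceNorm_nonneg (M : Matrix H H ℂ) : 0 ≤ traceNorm M :=
  (Complex.nonneg_iff.1 (sqrt_posSemidef (Mᴴ * M)).trace_nonneg).1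

theorem traceNorm_add_le (M N : Matrix H H ℂ) :
    traceNorm (M + N) ≤ traceNorm M + traceNorm N := by
  obtain ⟨U, hU, h⟩ := exists_unitary_re_trace_eq_traceNorm (M + N)
  rw [← h, Matrix.mul_add, trace_add, Complex.add_re]
  exact add_le_add (re_trace_mul_le_traceNorm hU M) (re_trace_mul_le_traceNorm hU N)

theorem traceNorm_of_posSemidef {M : Matrix H H ℂ} (hM : M.PosSemidef) :
    traceNorm M = M.trace.re := by
  rw [traceNorm, hM.isHermitian.eq, CFC.sqrt_mul_self M hM.nonneg]

theorem traceNorm_zero : traceNorm (0 : Matrix H H ℂ) = 0 := by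
  rw [traceNorm_of_posSemidef PosSemidef.zero]
  simp

theorem traceNorm_neg (M : Matrix H H ℂ) : traceNorm (-M) = traceNorm M := by
  simp [traceNorm]

theorem traceNorm_sub_le (M N : Matrix H H ℂ) :
    traceNorm (M - N) ≤ traceNorm M + traceNorm N := by
  rw [sub_eq_add_neg, ← traceNorm_neg N]
  exact traceNorm_add_le _ _

theorem traceNorm_smul (c : ℝ) (M : Matrix H H ℂ) : traceNorm (c • M) = |c| * traceNorm M := by
  have h : CFC.sqrt ((c • M)ᴴ * (c • M)) = |c| • CFC.sqrt (Mᴴ * M) := by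
    apply CFC.sqrt_unique
    · rw [smul_mul_smul_comm, sqrt_mul_sqrt_conjTranspose_mul_self, abs_mul_abs_self,
        conjTranspose_smul, smul_mul_smul_comm, star_trivial]
    · exact ((sqrt_posSemidef (Mᴴ * M)).smul (abs_nonneg c)).nonneg
  rw [traceNorm, h, traceNorm, trace_smul]
  simp

theorem traceNorm_sum_le {ι : Type*} (s : Finset ι) (M : ι → Matrix H H ℂ) :
    traceNorm (∑ i ∈ s, M i) ≤ ∑ i ∈ s, traceNorm (M i) :=
  Finset.le_sum_of_subadditive _ traceNorm_zero.le traceNorm_add_le s M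

theorem posSemidef_single {Z : Type*} [Fintype Z] [DecidableEq Z] (z : Z) :
    (single z z (1 : ℂ)).PosSemidef := by
  rw [← diagonal_single]
  apply PosSemidef.diagonal
  intro i
  by_cases h : i = z
  · subst h; simp
  · simp [h]

theorem traceNorm_single_kronecker {Z : Type*} [Fintype Z] [DecidableEq Z] (z : Z)
    (M : Matrix H H ℂ) : traceNorm (single z z (1 : ℂ) ⊗ₖ M) = traceNorm M := by
  have h : CFC.sqrt ((single z z (1 : ℂ) ⊗ₖ M)ᴴ * (single z z (1 : ℂ) ⊗ₖ M))
      = single z z (1 : ℂ) ⊗ₖ CFC.sqrt (Mᴴ * M) := by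
    apply CFC.sqrt_unique
    · rw [← mul_kronecker_mul, sqrt_mul_sqrt_conjTranspose_mul_self, conjTranspose_kronecker,
        ← mul_kronecker_mul]
      simp
    · exact ((posSemidef_single z).kronecker (sqrt_posSemidef _)).nonneg
  rw [traceNorm, h, trace_kronecker, trace_single_eq_same, one_mul, traceNorm]

/-- The diagonal blocks of an operator on a bipartite system, `⟨x| ρ |x⟩`. -/
def diagBlock {X E : Type*} (M : Matrix (X × E) (X × E) ℂ) (x : X) : Matrix E E ℂ :=
  M.submatrix (Prod.mk x) (Prod.mk x)

theorem trace_eq_sum_trace_diagBlock {X E : Type*} [Fintype X] [Fintype E]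
    (M : Matrix (X × E) (X × E) ℂ) : M.trace = ∑ x, (diagBlock M x).trace := by
  simp [Matrix.trace, diagBlock, Fintype.sum_prod_type]

theorem cqState_apply {X E : Type*} [Fintype X] [DecidableEq X] (ρ : X → Matrix E E ℂ)
    (x x' : X) (e e' : E) :
    cqState ρ (x, e) (x', e') = if x = x' then ρ x e e' else 0 := by
  rw [cqState, Matrix.sum_apply, Finset.sum_eq_single x]
  · simp [kroneckerMap_apply, single_apply]
  · intro y _ hy
    simp [kroneckerMap_apply, hy]
  · simp

theorem diagBlock_cqState {X E : Type*} [Fintype X] [DecidableEq X] (ρ : X → Matrix E E ℂ)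
    (x : X) : diagBlock (cqState ρ) x = ρ x := by
  ext e e'
  simp [diagBlock, cqState_apply]

theorem cqState_const_one {X E : Type*} [Fintype X] [DecidableEq X] [DecidableEq E] :
    cqState (fun _ : X => (1 : Matrix E E ℂ)) = 1 := by
  ext ⟨x, e⟩ ⟨x', e'⟩
  simp only [cqState_apply, Matrix.one_apply, Prod.mk.injEq]
  split_ifs <;> simp_all

/-- Pinching does not increase the trace norm. -/
theorem sum_traceNorm_diagBlock_le {X E : Type*} [Fintype X] [DecidableEq X] [Fintype E]
    [DecidableEq E] (M : Matrix (X × E) (X × E) ℂ) :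
    ∑ x, traceNorm (diagBlock M x) ≤ traceNorm M := by
  choose U hU h using fun x => exists_unitary_re_trace_eq_traceNorm (diagBlock M x)
  have hVV : (cqState U)ᴴ * cqState U = 1 := by
    rw [← cqState_const_one]
    ext ⟨x, e⟩ ⟨x', e'⟩
    rw [cqState_apply, ← hU x]
    simp only [Matrix.mul_apply, Fintype.sum_prod_type, conjTranspose_apply, cqState_apply]
    rw [Finset.sum_eq_single x]
    · by_cases hx : x = x' <;> simp [hx]
    · intro y _ hy
      simp [hy]
    · simp
  refine le_trans (le_of_eq ?_) (re_trace_mul_le_traceNorm hVV M)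
  rw [trace_eq_sum_trace_diagBlock, Complex.re_sum]
  refine Finset.sum_congr rfl fun x _ => ?_
  rw [← h x]
  congr 2
  ext e e'
  simp only [diagBlock, submatrix_apply, Matrix.mul_apply, Fintype.sum_prod_type, cqState_apply]
  rw [Finset.sum_eq_single x]
  · simp
  · intro y _ hy
    simp [hy.symm]
  · simp

/-- The Fuchs–van de Graaf inequality `‖ρ - τ‖₁² ≤ (tr ρ + tr τ)² - (2 F)²` for positive operators,
with the fidelity `F = ‖√ρ √τ‖₁ ≤ (tr ρ + tr τ) / 2`. -/
theorem traceNorm_sub_le_sqrt {ρ τ : Matrix H H ℂ} (hρ : ρ.PosSemidef) (hτ : τ.PosSemidef) :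
    2 * traceNorm (CFC.sqrt ρ * CFC.sqrt τ) ≤ ρ.trace.re + τ.trace.re ∧
    traceNorm (ρ - τ) ≤ √((ρ.trace.re + τ.trace.re) ^ 2
      - (2 * traceNorm (CFC.sqrt ρ * CFC.sqrt τ)) ^ 2) := by
  set A := CFC.sqrt ρ with hA
  set B := CFC.sqrt τ with hB
  have hAh : Aᴴ = A := (sqrt_posSemidef ρ).isHermitian.eq
  have hBh : Bᴴ = B := (sqrt_posSemidef τ).isHermitian.eq
  have hAA : A * A = ρ := sqrt_mul_sqrt hρ
  have hBB : B * B = τ := sqrt_mul_sqrt hτ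
  obtain ⟨U, hU, hUF⟩ := exists_unitary_re_trace_eq_traceNorm (A * B)
  -- Rotating `√τ` by the unitary of the polar decomposition of `√ρ √τ` turns the fidelity
  -- into a Hilbert–Schmidt inner product.
  set C := B * U with hC
  have hCC : C * Cᴴ = τ := by
    rw [hC, conjTranspose_mul, hBh, Matrix.mul_assoc, ← Matrix.mul_assoc U,
      mul_eq_one_comm.1 hU, Matrix.one_mul, hBB]
  have hCC' : (Cᴴ * C).trace = τ.trace := by rw [trace_mul_comm, hCC]
  have hAC : (A * C).trace.re = traceNorm (A * B) := by
    rw [← hUF, trace_mul_comm U, hC, Matrix.mul_assoc]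
  have hCA : (Cᴴ * A).trace.re = traceNorm (A * B) := by
    rw [← hAC, ← Complex.conj_re (A * C).trace]
    congr 1
    change _ = star (A * C).trace
    rw [← trace_conjTranspose, conjTranspose_mul A C, hAh]
  have hm : ((A - C)ᴴ * (A - C)).trace.re
      = ρ.trace.re + τ.trace.re - 2 * traceNorm (A * B) := by
    simp only [conjTranspose_sub, hAh, Matrix.sub_mul, Matrix.mul_sub, trace_sub, Complex.sub_re,
      hAA, hAC, hCA, hCC']
    ring
  have hp : ((A + C)ᴴ * (A + C)).trace.re
      = ρ.trace.re + τ.trace.re + 2 * traceNorm (A * B) := by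
    simp only [conjTranspose_add, hAh, Matrix.add_mul, Matrix.mul_add, trace_add, Complex.add_re,
      hAA, hAC, hCA, hCC']
    ring
  have hm0 := re_trace_conjTranspose_mul_self_nonneg (A - C)
  have hp0 := re_trace_conjTranspose_mul_self_nonneg (A + C)
  refine ⟨by linarith, ?_⟩
  obtain ⟨W, hW, hWF⟩ := exists_unitary_re_trace_eq_traceNorm (ρ - τ)
  have hWW : W * Wᴴ = 1 := mul_eq_one_comm.1 hW
  -- Cauchy–Schwarz for `W X Yᴴ`, with `{X, Y} = {A - C, A + C}`
  have cs : ∀ X Y : Matrix H H ℂ, (W * (X * Yᴴ)).trace.re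
      ≤ √((Yᴴ * Y).trace.re) * √((Xᴴ * X).trace.re) := by
    intro X Y
    have h := re_trace_conjTranspose_mul_le Y (W * X)
    have e : (W * X)ᴴ * (W * X) = Xᴴ * X := by
      rw [conjTranspose_mul, Matrix.mul_assoc, ← Matrix.mul_assoc Wᴴ, hW, Matrix.one_mul]
    rwa [e, trace_mul_comm, Matrix.mul_assoc] at h
  have split : (2 : ℂ) • (ρ - τ) = (A - C) * (A + C)ᴴ + (A + C) * (A - C)ᴴ := by
    simp only [conjTranspose_add, conjTranspose_sub, hAh, Matrix.sub_mul, Matrix.mul_sub,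
      Matrix.add_mul, Matrix.mul_add, hAA, hCC, two_smul]
    abel
  have h2 : 2 * traceNorm (ρ - τ) = (W * ((A - C) * (A + C)ᴴ)).trace.re
      + (W * ((A + C) * (A - C)ᴴ)).trace.re := by
    rw [← hWF, ← Complex.add_re, ← trace_add, ← Matrix.mul_add, ← split, mul_smul_comm, trace_smul]
    simp
  have h3 := cs (A - C) (A + C)
  have h4 := cs (A + C) (A - C)
  rw [hm, hp] at h3 h4
  rw [hm] at hm0
  rw [hp] at hp0
  rw [sq_sub_sq, Real.sqrt_mul hp0]
  linarith

/-- The reverse triangle inequality for future-directed causal vectors `(p, f)`, `(q, g)` of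
two-dimensional Minkowski space. -/
theorem sqrt_sq_sub_sq_add_le {p f q g : ℝ} (hf : 0 ≤ f) (hg : 0 ≤ g) (hp : f ≤ p) (hq : g ≤ q) :
    √(p ^ 2 - f ^ 2) + √(q ^ 2 - g ^ 2) ≤ √((p + q) ^ 2 - (f + g) ^ 2) := by
  have h1 : 0 ≤ p ^ 2 - f ^ 2 := by nlinarith
  have h2 : 0 ≤ q ^ 2 - g ^ 2 := by nlinarith
  apply Real.le_sqrt_of_sq_le
  rw [add_sq, Real.sq_sqrt h1, Real.sq_sqrt h2, mul_assoc, ← Real.sqrt_mul h1]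
  have h3 : √((p ^ 2 - f ^ 2) * (q ^ 2 - g ^ 2)) ≤ p * q - f * g := by
    rw [Real.sqrt_le_iff]
    refine ⟨by nlinarith, ?_⟩
    nlinarith [sq_nonneg (p * g - q * f)]
  linarith

/-- The purified distance bounds the generalized trace distance of sub-normalized states. The
two terms of the generalized fidelity are the fidelities of `ρ`, `τ` and of the numbers
`1 - tr ρ`, `1 - tr τ` that complete them to normalized states. -/
theorem generalizedTraceDist_le_purifiedDist {ρ τ : Matrix H H ℂ} (hρ : IsSubnormalizedState ρ)
    (hτ : IsSubnormalizedState τ) :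
    1 / 2 * traceNorm (ρ - τ) + 1 / 2 * |ρ.trace.re - τ.trace.re| ≤ purifiedDist ρ τ := by
  obtain ⟨hF, hD⟩ := traceNorm_sub_le_sqrt hρ.1 hτ.1
  have hF0 := traceNorm_nonneg (CFC.sqrt ρ * CFC.sqrt τ)
  rw [purifiedDist, genFidelity]
  set F := traceNorm (CFC.sqrt ρ * CFC.sqrt τ)
  set t := ρ.trace.re
  set s := τ.trace.re
  have ht : 0 ≤ 1 - t := sub_nonneg.2 hρ.2.2
  have hs : 0 ≤ 1 - s := sub_nonneg.2 hτ.2.2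
  set G := √((1 - t) * (1 - s))
  have hG : G ^ 2 = (1 - t) * (1 - s) := Real.sq_sqrt (mul_nonneg ht hs)
  have hG0 : 0 ≤ G := Real.sqrt_nonneg _
  have hGle : 2 * G ≤ 1 - t + (1 - s) := by
    apply le_of_sq_le_sq _ (by linarith)
    nlinarith [sq_nonneg (t - s)]
  have habs : |t - s| = √((1 - t + (1 - s)) ^ 2 - (2 * G) ^ 2) := by
    rw [← Real.sqrt_sq_eq_abs]
    congr 1
    rw [mul_pow, hG]
    ring
  have h := sqrt_sq_sub_sq_add_le (by linarith) (by linarith) hF hGle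
  have e : √((t + s + (1 - t + (1 - s))) ^ 2 - (2 * F + 2 * G) ^ 2) = 2 * √(1 - (F + G) ^ 2) := by
    rw [show (t + s + (1 - t + (1 - s))) ^ 2 - (2 * F + 2 * G) ^ 2
      = 2 ^ 2 * (1 - (F + G) ^ 2) by ring, Real.sqrt_mul (by norm_num), Real.sqrt_sq (by norm_num)]
  rw [e] at h
  rw [habs]
  linarith

end TraceNorm

/-! ### Collision probability of the hash family -/

section Collisions

open Polynomial in
/-- Polynomial hashing has few colliding seeds: two inputs collide exactly at the roots of the
nonzero polynomial `∑ i, (x i - x' i) X ^ (r - 1 - i)`. -/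
theorem card_le_of_polyHash_eq {K : Type*} [Field K] {r : ℕ} {x x' : Fin r → K} (hx : x ≠ x')
    (s : Finset K) (hs : ∀ α ∈ s, polyHash α x = polyHash α x') : s.card ≤ r - 1 := by
  classical
  set p : K[X] := ∑ i : Fin r, C (x i - x' i) * X ^ (r - 1 - (i : ℕ)) with hp
  obtain ⟨i, hi⟩ := Function.ne_iff.1 hx
  have hcoeff : p.coeff (r - 1 - (i : ℕ)) = x i - x' i := by
    rw [hp, finsetSum_coeff, Finset.sum_eq_single i]
    · rw [coeff_C_mul, coeff_X_pow_self, mul_one]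
    · intro j _ hj
      have : r - 1 - (i : ℕ) ≠ r - 1 - (j : ℕ) := by
        intro h
        apply hj
        ext
        omega
      rw [coeff_C_mul, coeff_X_pow, if_neg this, mul_zero]
    · simp
  have hp0 : p ≠ 0 := by
    intro h
    rw [h, coeff_zero] at hcoeff
    exact hi (sub_eq_zero.1 hcoeff.symm)
  have hdeg : p.natDegree ≤ r - 1 :=
    natDegree_sum_le_of_forall_le _ _ fun j _ =>
      (natDegree_C_mul_X_pow_le _ _).trans (Nat.sub_le _ _)
  refine le_trans ?_ hdeg
  refine card_le_degree_of_subset_roots fun α hα => ?_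
  rw [mem_roots hp0, IsRoot.def, hp, eval_finsetSum]
  have h := hs α hα
  rw [polyHash, polyHash, ← sub_eq_zero, ← Finset.sum_sub_distrib] at h
  rw [← h]
  exact Finset.sum_congr rfl fun j _ => by simp [sub_mul]

theorem exists_bitBlock_ne {n k : ℕ} (hk : 0 < k) {x x' : BitString n} (hx : x ≠ x') :
    ∃ i : Fin (n ⌈/⌉ k), bitBlock k x i ≠ bitBlock k x' i := by
  obtain ⟨j, hj⟩ := Function.ne_iff.1 hx
  have hlt : (j : ℕ) / k < n ⌈/⌉ k := by
    rw [Nat.ceilDiv_eq_add_pred_div, Nat.div_lt_iff_lt_mul hk]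
    have h1 := Nat.div_add_mod (n + k - 1) k
    have h2 := Nat.mod_lt (n + k - 1) hk
    have h3 := j.2
    rw [mul_comm] at h1
    omega
  refine ⟨⟨j / k, hlt⟩, fun h => hj ?_⟩
  have h1 := congrFun h ⟨j % k, Nat.mod_lt _ hk⟩
  simpa [bitBlock, Nat.div_add_mod'] using h1

/-- A `k`-bit string whose `ℓ` lowest bits vanish is determined by its other `k - ℓ` bits. -/
theorem card_lowBits_eq_zero_le {k ℓ : ℕ} (hℓk : ℓ ≤ k) :
    (Finset.univ.filter fun γ : BitString k => lowBits ℓ γ = 0).card ≤ 2 ^ (k - ℓ) := by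
  have hcard : Fintype.card (BitString (k - ℓ)) = 2 ^ (k - ℓ) := by simp [BitString]
  rw [← hcard, ← Finset.card_univ]
  refine Finset.card_le_card_of_injOn
    (fun γ => fun j : Fin (k - ℓ) => γ ⟨ℓ + j, by omega⟩) (fun _ _ => Finset.mem_univ _) ?_
  intro γ hγ γ' hγ' h
  simp only [Finset.coe_filter, Finset.mem_univ, true_and, Set.mem_ofPred_eq] at hγ hγ'
  ext1 j
  by_cases hj : (j : ℕ) < ℓ
  · have h1 := congrFun (hγ.trans hγ'.symm) ⟨j, hj⟩
    simpa [lowBits] using h1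
  · have h1 := congrFun h ⟨j - ℓ, by omega⟩
    have h2 : ℓ + ((j : ℕ) - ℓ) = j := by omega
    simpa [h2] using h1

/-- Multiplicative hashing is two-universal, as `β ↦ (y - y') β` is injective for `y ≠ y'`. -/
theorem card_multHashBits_eq_le {k ℓ : ℕ} (hℓk : ℓ ≤ k)
    (b : Module.Basis (Fin k) (ZMod 2) (GaloisField 2 k)) {y y' : BitString k} (hy : y ≠ y') :
    (Finset.univ.filter fun β => multHashBits b ℓ β y = multHashBits b ℓ β y').card
      ≤ 2 ^ (k - ℓ) := by
  refine le_trans ?_ (card_lowBits_eq_zero_le hℓk)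
  have hd : b.equivFun.symm y - b.equivFun.symm y' ≠ 0 :=
    sub_ne_zero.2 fun h => hy (b.equivFun.symm.injective h)
  refine Finset.card_le_card_of_injOn
    (fun β => b.equivFun ((b.equivFun.symm y - b.equivFun.symm y') * b.equivFun.symm β)) ?_ ?_
  · intro β hβ
    simp only [Finset.coe_filter, Finset.mem_univ, true_and, Set.mem_ofPred_eq] at hβ ⊢
    ext1 j
    have h := congrFun hβ j
    simp only [multHashBits, lowBits] at h ⊢
    rw [sub_mul, map_sub]
    split_ifs at h ⊢ with hj
    · rw [Pi.sub_apply, h, sub_self]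
      rfl
    · rfl
  · intro β _ β' _ h
    exact b.equivFun.symm.injective (mul_left_cancel₀ hd (b.equivFun.injective h))

theorem composedHash_apply {n k ℓ : ℕ} (b : Module.Basis (Fin k) (ZMod 2) (GaloisField 2 k))
    (α β : BitString k) (x : BitString n) :
    composedHash b n ℓ (α, β) x = multHashBits b ℓ β (polyHashBits b n α x) := rfl

/-- Two inputs collide if their polynomial hashes do, or else if the multiplicative hash of two
distinct strings does. -/
theorem card_composedHash_eq_le {n k ℓ : ℕ} (hk : 0 < k) (hℓk : ℓ ≤ k)
    (b : Module.Basis (Fin k) (ZMod 2) (GaloisField 2 k)) {x x' : BitString n} (hx : x ≠ x') :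
    (Finset.univ.filter fun s => composedHash b n ℓ s x = composedHash b n ℓ s x').card
      ≤ (n ⌈/⌉ k - 1) * 2 ^ k + 2 ^ k * 2 ^ (k - ℓ) := by
  have hcard : Fintype.card (BitString k) = 2 ^ k := by simp [BitString]
  have hpoly : (Finset.univ.filter fun α =>
      polyHashBits b n α x = polyHashBits b n α x').card ≤ n ⌈/⌉ k - 1 := by
    obtain ⟨i, hi⟩ := exists_bitBlock_ne hk hx
    have hne : (fun i : Fin (n ⌈/⌉ k) => b.equivFun.symm (bitBlock k x i))
        ≠ fun i : Fin (n ⌈/⌉ k) => b.equivFun.symm (bitBlock k x' i) :=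
      fun h => hi (b.equivFun.symm.injective (congrFun h i))
    rw [← Finset.card_map b.equivFun.symm.toEquiv.toEmbedding]
    refine card_le_of_polyHash_eq hne _ fun α hα => ?_
    obtain ⟨a, ha, rfl⟩ := Finset.mem_map.1 hα
    exact b.equivFun.injective (Finset.mem_filter.1 ha).2
  have hfib : ∀ α : BitString k, (Finset.univ.filter fun β =>
      composedHash b n ℓ (α, β) x = composedHash b n ℓ (α, β) x').card
      ≤ (if polyHashBits b n α x = polyHashBits b n α x' then 2 ^ k else 0) + 2 ^ (k - ℓ) := by
    intro α
    split_ifs with h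
    · refine le_trans (Finset.card_le_univ _) ?_
      rw [hcard]
      exact Nat.le_add_right _ _
    · rw [zero_add]
      simp only [composedHash_apply]
      exact card_multHashBits_eq_le hℓk b h
  have hsum : (Finset.univ.filter fun s =>
      composedHash b n ℓ s x = composedHash b n ℓ s x').card
      = ∑ α, (Finset.univ.filter fun β =>
        composedHash b n ℓ (α, β) x = composedHash b n ℓ (α, β) x').card := by
    simp only [Finset.card_filter, Fintype.sum_prod_type]
  rw [hsum]
  refine (Finset.sum_le_sum fun α _ => hfib α).trans ?_
  rw [Finset.sum_add_distrib, Finset.sum_const, Finset.card_univ, hcard, smul_eq_mul,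
    ← Finset.sum_filter, Finset.sum_const, smul_eq_mul]
  gcongr

/-- The collision probability of the composed family is at most `2 ^ (-ℓ) (1 + 4 ε²)`: the `r - 1`
bad polynomial seeds number less than `n / k ≤ n / ℓ`. -/
theorem composedHash_collision_bound {n k ℓ : ℕ} (hℓ : 0 < ℓ) (hℓk : ℓ ≤ k) {ε : ℝ}
    (hk : (2 : ℝ) ^ ℓ * (n / ℓ) ≤ 4 * ε ^ 2 * 2 ^ k)
    (b : Module.Basis (Fin k) (ZMod 2) (GaloisField 2 k)) {x x' : BitString n} (hx : x ≠ x') :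
    (2 : ℝ) ^ ℓ * (Finset.univ.filter fun s =>
        composedHash b n ℓ s x = composedHash b n ℓ s x').card
      ≤ (1 + 4 * ε ^ 2) * Fintype.card (BitString k × BitString k) := by
  have hk0 : 0 < k := hℓ.trans_le hℓk
  have hkR : (0 : ℝ) < k := by exact_mod_cast hk0
  have hcard : (Fintype.card (BitString k × BitString k) : ℝ) = 2 ^ k * 2 ^ k := by
    simp [BitString]
  have h := card_composedHash_eq_le hk0 hℓk b hx
  have hr : (n ⌈/⌉ k - 1) * k ≤ n := by
    rw [Nat.ceilDiv_eq_add_pred_div]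
    have h1 := Nat.div_mul_le_self (n + k - 1) k
    rw [Nat.sub_mul, one_mul]
    omega
  have hrR : ((n ⌈/⌉ k - 1 : ℕ) : ℝ) ≤ n / ℓ := by
    calc ((n ⌈/⌉ k - 1 : ℕ) : ℝ) ≤ n / k := by
          rw [le_div_iff₀ hkR]
          exact_mod_cast hr
      _ ≤ n / ℓ := by gcongr
  have hpow : (2 : ℝ) ^ ℓ * 2 ^ (k - ℓ) = 2 ^ k := by
    rw [← pow_add, Nat.add_sub_cancel' hℓk]
  calc (2 : ℝ) ^ ℓ * (Finset.univ.filter fun s =>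
        composedHash b n ℓ s x = composedHash b n ℓ s x').card
      ≤ 2 ^ ℓ * (((n ⌈/⌉ k - 1 : ℕ) : ℝ) * 2 ^ k + 2 ^ k * 2 ^ (k - ℓ)) := by
        gcongr
        exact_mod_cast h
    _ = (2 ^ ℓ * ((n ⌈/⌉ k - 1 : ℕ) : ℝ)) * 2 ^ k + 2 ^ k * 2 ^ k := by
        rw [← hpow]; ring
    _ ≤ (4 * ε ^ 2 * 2 ^ k) * 2 ^ k + 2 ^ k * 2 ^ k := by
        have h1 : (2 : ℝ) ^ ℓ * ((n ⌈/⌉ k - 1 : ℕ) : ℝ) ≤ 4 * ε ^ 2 * 2 ^ k :=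
          (mul_le_mul_of_nonneg_left hrR (by positivity)).trans hk
        exact add_le_add_left (mul_le_mul_of_nonneg_right h1 (by positivity)) _
    _ = _ := by rw [hcard]; ring

end Collisions

/-! ### Weighted Hilbert–Schmidt forms -/

section WeightedForm

open Matrix

variable {E : Type*} [Fintype E] [DecidableEq E]

theorem re_trace_mul_nonneg {A B : Matrix E E ℂ} (hA : A.PosSemidef) (hB : B.PosSemidef) :
    0 ≤ (A * B).trace.re := by
  have h := (hB.conjTranspose_mul_mul_same (CFC.sqrt A)).trace_nonneg
  rw [(sqrt_posSemidef A).isHermitian.eq, Matrix.mul_assoc, trace_mul_comm, Matrix.mul_assoc,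
    sqrt_mul_sqrt hA, trace_mul_comm] at h
  exact (Complex.nonneg_iff.1 h).1

/-- The real bilinear form `⟨a, b⟩ = Re tr ((ν a ν)† (ν b ν))`. For Hermitian `a`, `b` and
`ν = ω ^ (-1/4)` it is `tr (ω ^ (-1/2) a ω ^ (-1/2) b)`. -/
noncomputable def weightedForm {E : Type*} [Fintype E] (ν : Matrix E E ℂ) : LinearMap.BilinForm ℝ (Matrix E E ℂ) :=
  LinearMap.mk₂ ℝ (fun a b => ((ν * a * ν)ᴴ * (ν * b * ν)).trace.re)
    (fun a a' b => by simp [Matrix.mul_add, Matrix.add_mul])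
    (fun c a b => by simp)
    (fun a b b' => by simp [Matrix.mul_add, Matrix.add_mul])
    (fun c a b => by simp)

theorem weightedForm_apply {E : Type*} [Fintype E] (ν a b : Matrix E E ℂ) :
    weightedForm ν a b = ((ν * a * ν)ᴴ * (ν * b * ν)).trace.re := rfl

theorem weightedForm_nonneg {ν a b : Matrix E E ℂ} (hν : νᴴ = ν) (ha : a.PosSemidef)
    (hb : b.PosSemidef) : 0 ≤ weightedForm ν a b := by
  have h : ∀ c : Matrix E E ℂ, c.PosSemidef → (ν * c * ν).PosSemidef := fun c hc => by
    have := hc.conjTranspose_mul_mul_same ν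
    rwa [hν] at this
  exact re_trace_mul_nonneg (h a ha).conjTranspose (h b hb)

/-- The trace norm is bounded by a weighted Hilbert–Schmidt norm, with weight `ω = κ ^ 4`. -/
theorem traceNorm_le_sqrt_weightedForm {κ ν : Matrix E E ℂ} (hκ : κᴴ = κ) (h : κ * ν = 1)
    (M : Matrix E E ℂ) :
    traceNorm M ≤ √((κ * κ * (κ * κ)).trace.re) * √(weightedForm ν M M) := by
  have h' : ν * κ = 1 := mul_eq_one_comm.1 h
  obtain ⟨U, hU, hUM⟩ := exists_unitary_re_trace_eq_traceNorm M
  have e1 : (U * M).trace = ((κ * Uᴴ * κ)ᴴ * (ν * M * ν)).trace := by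
    have : (κ * Uᴴ * κ)ᴴ * (ν * M * ν) = κ * (U * M) * ν := by
      simp only [conjTranspose_mul, conjTranspose_conjTranspose, hκ]
      calc κ * (U * κ) * (ν * M * ν) = κ * U * (κ * ν) * M * ν := by simp only [Matrix.mul_assoc]
        _ = κ * (U * M) * ν := by rw [h, Matrix.mul_one]; simp only [Matrix.mul_assoc]
    rw [this, trace_mul_comm (κ * (U * M)) ν, ← Matrix.mul_assoc, h', Matrix.one_mul]
  have e2 : ((κ * Uᴴ * κ)ᴴ * (κ * Uᴴ * κ)).trace.re ≤ (κ * κ * (κ * κ)).trace.re := by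
    have h1 : ((κ * Uᴴ * κ)ᴴ * (κ * Uᴴ * κ)).trace
        = ((κ * κ)ᴴ * (U * (κ * κ) * Uᴴ)).trace := by
      simp only [conjTranspose_mul, conjTranspose_conjTranspose, hκ]
      rw [← Matrix.mul_assoc, trace_mul_comm _ κ]
      simp only [Matrix.mul_assoc]
    have h2 : (U * (κ * κ) * Uᴴ)ᴴ * (U * (κ * κ) * Uᴴ) = U * (κ * κ * (κ * κ)) * Uᴴ := by
      simp only [conjTranspose_mul, conjTranspose_conjTranspose, hκ]
      calc U * (κ * κ * Uᴴ) * (U * (κ * κ) * Uᴴ) = U * (κ * κ * (Uᴴ * U) * (κ * κ)) * Uᴴ := by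
            simp only [Matrix.mul_assoc]
        _ = _ := by rw [hU, Matrix.mul_one]
    have h3 : (U * (κ * κ * (κ * κ)) * Uᴴ).trace = (κ * κ * (κ * κ)).trace := by
      rw [trace_mul_comm, ← Matrix.mul_assoc, hU, Matrix.one_mul]
    have h4 := re_trace_conjTranspose_mul_le (κ * κ) (U * (κ * κ) * Uᴴ)
    have h5 := re_trace_conjTranspose_mul_self_nonneg (κ * κ)
    rw [← h1, h2, h3] at h4
    simp only [conjTranspose_mul, hκ] at h4 h5 ⊢
    rwa [Real.mul_self_sqrt h5] at h4
  rw [← hUM, e1]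
  refine (re_trace_conjTranspose_mul_le _ _).trans ?_
  rw [weightedForm_apply]
  gcongr

/-- Operators dominated by `c ω` with `ω = κ ^ 4` satisfy `tr (ω ^ (-1/2) a ω ^ (-1/2) a) ≤ c tr a`,
because `ω ^ (-1/2) a ω ^ (-1/2) ≤ c`. -/
theorem weightedForm_self_le {κ ν a : Matrix E E ℂ} (hν : νᴴ = ν) (h : κ * ν = 1)
    (ha : a.PosSemidef) {c : ℝ} (hc : a ≤ c • (κ * κ * (κ * κ))) :
    weightedForm ν a a ≤ c * a.trace.re := by
  have h' : ν * κ = 1 := mul_eq_one_comm.1 h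
  have hpos : (c • (1 : Matrix E E ℂ) - ν * ν * a * (ν * ν)).PosSemidef := by
    have h1 := (Matrix.le_iff.1 hc).conjTranspose_mul_mul_same (ν * ν)
    have h2 : ν * ν * (κ * κ * (κ * κ)) * (ν * ν) = 1 := by
      calc ν * ν * (κ * κ * (κ * κ)) * (ν * ν)
          = ν * (ν * κ) * κ * (κ * (κ * ν) * ν) := by simp only [Matrix.mul_assoc]
        _ = 1 := by rw [h, h', Matrix.mul_one, Matrix.mul_one, h, h', Matrix.mul_one]
    rwa [conjTranspose_mul, hν, Matrix.mul_sub, Matrix.sub_mul, mul_smul_comm, smul_mul_assoc,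
      h2] at h1
  have h3 := re_trace_mul_nonneg ha hpos
  have h4 : weightedForm ν a a = (a * (ν * ν * a * (ν * ν))).trace.re := by
    rw [weightedForm_apply]
    simp only [conjTranspose_mul, hν, ha.isHermitian.eq]
    rw [← Matrix.mul_assoc ν a ν, trace_mul_comm, Matrix.mul_assoc ν a ν, Matrix.mul_assoc ν,
      trace_mul_comm]
    simp only [Matrix.mul_assoc]
  rw [Matrix.mul_sub, trace_sub, Complex.sub_re, ← h4, mul_smul_comm, Matrix.mul_one,
    trace_smul] at h3
  simpa using h3

theorem exists_fourth_root {ω : Matrix E E ℂ} (hω : ω.PosDef) :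
    ∃ κ ν : Matrix E E ℂ, κᴴ = κ ∧ νᴴ = ν ∧ κ * ν = 1 ∧ κ * κ * (κ * κ) = ω := by
  set κ := CFC.sqrt (CFC.sqrt ω)
  have hκ : κᴴ = κ := (sqrt_posSemidef _).isHermitian.eq
  have h4 : κ * κ * (κ * κ) = ω := by
    rw [sqrt_mul_sqrt (sqrt_posSemidef _), sqrt_mul_sqrt hω.posSemidef]
  have hu : IsUnit κ.det := by
    have h1 := (Matrix.isUnit_iff_isUnit_det ω).1 hω.isUnit
    rw [← h4, det_mul, det_mul] at h1
    exact isUnit_of_mul_isUnit_left (isUnit_of_mul_isUnit_left h1)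
  exact ⟨κ, κ⁻¹, hκ, by rw [conjTranspose_nonsing_inv, hκ], mul_nonsing_inv κ hu, h4⟩

end WeightedForm

/-! ### The leftover hash lemma -/

section LeftoverHash

variable {S X Z : Type*} [Fintype S] [Fintype X] [Fintype Z] [DecidableEq Z]

/-- The second-moment computation behind the leftover hash lemma. Only pairs `x`, `x'` with equal
hash values contribute to the second moment; the nonnegativity of `B (v x) (v x')` lets one replace
their collision probability by its upper bound `c / |Z|`. -/
theorem sum_sq_hash_deviation_le [DecidableEq X] [Nonempty Z] {V : Type*} [AddCommGroup V]
    [Module ℝ V] (B : LinearMap.BilinForm ℝ V) (v : X → V) (hv : ∀ x x', 0 ≤ B (v x) (v x'))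
    (f : S → X → Z) {c : ℝ} (hc : 0 ≤ c)
    (hf : ∀ x x', x ≠ x' → (Fintype.card Z : ℝ) *
      (Finset.univ.filter fun s => f s x = f s x').card ≤ c * Fintype.card S) :
    Fintype.card Z * ∑ s, ∑ z,
      B (∑ x with f s x = z, v x - (Fintype.card Z : ℝ)⁻¹ • ∑ x, v x)
        (∑ x with f s x = z, v x - (Fintype.card Z : ℝ)⁻¹ • ∑ x, v x)
      ≤ Fintype.card S * (Fintype.card Z * ∑ x, B (v x) (v x)
        + (c - 1) * B (∑ x, v x) (∑ x, v x)) := by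
  set N : ℝ := (Fintype.card Z : ℝ) with hN
  have hN0 : N ≠ 0 := by simp [hN]
  set w := ∑ x, v x with hw
  have hvar : ∀ s, ∑ z, B (∑ x with f s x = z, v x - N⁻¹ • w) (∑ x with f s x = z, v x - N⁻¹ • w)
      = ∑ x, ∑ x', (if f s x = f s x' then B (v x) (v x') else 0) - N⁻¹ * B w w := by
    intro s
    have hfib : ∑ z, ∑ x with f s x = z, v x = w :=
      Finset.sum_fiberwise _ _ _
    have h1 : ∑ z, B (∑ x with f s x = z, v x) w = B w w := by
      rw [← LinearMap.sum_apply, ← map_sum, hfib]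
    have h2 : ∑ z, B w (∑ x with f s x = z, v x) = B w w := by
      rw [← map_sum, hfib]
    have h3 : ∑ z, B (∑ x with f s x = z, v x) (∑ x with f s x = z, v x)
        = ∑ x, ∑ x', (if f s x = f s x' then B (v x) (v x') else 0) := by
      simp only [map_sum, LinearMap.sum_apply]
      rw [← Finset.sum_fiberwise _ (fun x => f s x)]
      refine Finset.sum_congr rfl fun z _ => ?_
      rw [Finset.sum_comm]
      refine Finset.sum_congr rfl fun x hx => ?_
      rw [← Finset.sum_filter]
      refine Finset.sum_congr ?_ fun _ _ => rfl
      rw [(Finset.mem_filter.1 hx).2]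
      exact Finset.filter_congr fun _ _ => eq_comm
    simp only [map_sub, LinearMap.sub_apply, map_smul, LinearMap.smul_apply, smul_eq_mul,
      Finset.sum_sub_distrib, ← Finset.mul_sum, h1, h2, h3, Finset.sum_const, Finset.card_univ,
      nsmul_eq_mul, ← hN]
    field_simp
    ring
  have hpair : ∀ x x', N * (B (v x) (v x') * (Finset.univ.filter fun s => f s x = f s x').card)
      ≤ Fintype.card S * ((if x = x' then N * B (v x) (v x') else 0) + c * B (v x) (v x')) := by
    intro x x'
    have hB := hv x x'
    split_ifs with h
    · subst h
      have : 0 ≤ (Fintype.card S : ℝ) * (c * B (v x) (v x)) := by positivity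
      simp only [Finset.filter_true, Finset.card_univ]
      linarith
    · have := mul_le_mul_of_nonneg_right (hf x x' h) hB
      linarith
  have hcoll : ∑ s, ∑ x, ∑ x', (if f s x = f s x' then B (v x) (v x') else 0)
      = ∑ x, ∑ x', B (v x) (v x') * (Finset.univ.filter fun s => f s x = f s x').card := by
    rw [Finset.sum_comm]
    refine Finset.sum_congr rfl fun x _ => ?_
    rw [Finset.sum_comm]
    refine Finset.sum_congr rfl fun x' _ => ?_
    rw [← Finset.sum_filter, Finset.sum_const, nsmul_eq_mul, mul_comm]
  have hww : ∑ x, ∑ x', B (v x) (v x') = B w w := by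
    simp only [hw, map_sum, LinearMap.sum_apply]
    rw [Finset.sum_comm]
  simp only [hvar, Finset.sum_sub_distrib, hcoll, Finset.sum_const, Finset.card_univ, nsmul_eq_mul,
    mul_sub]
  have hsum := Finset.sum_le_sum fun x (_ : x ∈ Finset.univ) =>
    Finset.sum_le_sum fun x' (_ : x' ∈ Finset.univ) => hpair x x'
  simp only [← Finset.mul_sum, Finset.sum_add_distrib, hww, Finset.sum_ite_eq, Finset.mem_univ,
    if_true] at hsum
  have e : N * (Fintype.card S * (N⁻¹ * B w w)) = Fintype.card S * B w w := by
    field_simp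
  rw [e]
  linarith

/-- The leftover hash lemma for almost two-universal hashing against quantum side information: the
seed-averaged distance of the hash value from uniform, for `τ` satisfying `τ x ≤ μ σ` and collision
probability at most `c / |Z|`. -/
theorem leftover_hash {E : Type*} [Fintype E] [DecidableEq E] [DecidableEq X] [Nonempty Z]
    [Nonempty S] [Nonempty E] {τ : X → Matrix E E ℂ} (hτ : ∀ x, (τ x).PosSemidef)
    (htr : (∑ x, τ x).trace.re ≤ 1) {σ : Matrix E E ℂ} (hσ : IsNormalizedState σ) {μ : ℝ}
    (hμ : 0 ≤ μ) (hle : ∀ x, τ x ≤ μ • σ) (f : S → X → Z) {c : ℝ} (hc : 1 ≤ c)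
    (hf : ∀ x x', x ≠ x' → (Fintype.card Z : ℝ) *
      (Finset.univ.filter fun s => f s x = f s x').card ≤ c * Fintype.card S) :
    (Fintype.card S : ℝ)⁻¹ * ∑ s, ∑ z,
      traceNorm (∑ x with f s x = z, τ x - (Fintype.card Z : ℝ)⁻¹ • ∑ x, τ x)
      ≤ √(4 * (Fintype.card Z * μ) + 2 * (c - 1)) := by
  set N : ℝ := (Fintype.card Z : ℝ) with hN
  set s₀ : ℝ := (Fintype.card S : ℝ) with hs
  have hs0 : 0 < s₀ := by simp [hs, Fintype.card_pos]
  have hN0 : 0 < N := by simp [hN, Fintype.card_pos]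
  set d : ℝ := (Fintype.card E : ℝ) with hd
  have hd0 : 0 < d := by simp [hd, Fintype.card_pos]
  set w := ∑ x, τ x with hw
  have hwpos : w.PosSemidef := Matrix.posSemidef_sum _ fun x _ => hτ x
  -- The weight dominates `σ`, which controls the diagonal terms, as well as `w`, which controls
  -- the excess `c - 1` of the collision probability. The identity makes it invertible.
  set ω : Matrix E E ℂ := (4 * d)⁻¹ • (1 : Matrix E E ℂ) + ((1 / 4 : ℝ) • σ + (1 / 2 : ℝ) • w)
    with hω
  have hsmul : ∀ {r : ℝ} {A : Matrix E E ℂ}, 0 ≤ r → A.PosSemidef → (r • A).PosSemidef :=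
    fun hr hA => hA.smul hr
  have hωpos : ω.PosDef :=
    (Matrix.PosDef.one.smul (by positivity : 0 < (4 * d)⁻¹)).add_posSemidef
      ((hsmul (by norm_num) hσ.1).add (hsmul (by norm_num) hwpos))
  have hωtr : ω.trace.re ≤ 1 := by
    have : ω.trace.re = (4 * d)⁻¹ * d + (1 / 4 + 1 / 2 * w.trace.re) := by
      rw [hω]
      simp [Matrix.trace_add, Matrix.trace_smul, hσ.2, hd]
    rw [this]
    field_simp
    linarith
  obtain ⟨κ, ν, hκ, hν, hκν, h4⟩ := exists_fourth_root hωpos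
  have hwtr : 0 ≤ w.trace.re := (Complex.nonneg_iff.1 hwpos.trace_nonneg).1
  have hww : weightedForm ν w w ≤ 2 := by
    refine (weightedForm_self_le hν hκν hwpos (c := 2) ?_).trans (by linarith)
    rw [h4, Matrix.le_iff]
    have : (2 : ℝ) • ω - w = (2 * (4 * d)⁻¹) • (1 : Matrix E E ℂ) + (1 / 2 : ℝ) • σ := by
      rw [hω]
      module
    rw [this]
    exact (hsmul (by positivity) Matrix.PosSemidef.one).add (hsmul (by norm_num) hσ.1)
  have hττ : ∑ x, weightedForm ν (τ x) (τ x) ≤ 4 * μ := by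
    calc ∑ x, weightedForm ν (τ x) (τ x) ≤ ∑ x, (4 * μ) * (τ x).trace.re := by
          refine Finset.sum_le_sum fun x _ => weightedForm_self_le hν hκν (hτ x) ?_
          rw [h4, Matrix.le_iff]
          have : (4 * μ) • ω - τ x = (μ * d⁻¹) • (1 : Matrix E E ℂ)
              + ((μ • σ - τ x) + (2 * μ) • w) := by
            rw [hω, mul_inv]
            module
          rw [this]
          exact (hsmul (by positivity) Matrix.PosSemidef.one).add
            ((Matrix.le_iff.1 (hle x)).add (hsmul (by positivity) hwpos))
      _ = 4 * μ * w.trace.re := by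
          rw [hw, Matrix.trace_sum, Complex.re_sum, Finset.mul_sum]
      _ ≤ 4 * μ := by nlinarith
  set m : S → Z → Matrix E E ℂ := fun s z => ∑ x with f s x = z, τ x - N⁻¹ • w with hm
  have hsq := sum_sq_hash_deviation_le (weightedForm ν) τ
    (fun x x' => weightedForm_nonneg hν (hτ x) (hτ x')) f (zero_le_one.trans hc) hf
  have hmnn : ∀ s z, 0 ≤ weightedForm ν (m s z) (m s z) := fun s z =>
    re_trace_conjTranspose_mul_self_nonneg _
  have hnorm : ∀ s z, traceNorm (m s z) ≤ √(weightedForm ν (m s z) (m s z)) := by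
    intro s z
    refine (traceNorm_le_sqrt_weightedForm hκ hκν _).trans ?_
    rw [h4]
    exact mul_le_of_le_one_left (Real.sqrt_nonneg _) (Real.sqrt_le_one.2 hωtr)
  have hcs : (∑ s, ∑ z, √(weightedForm ν (m s z) (m s z))) ^ 2
      ≤ s₀ * (N * ∑ s, ∑ z, weightedForm ν (m s z) (m s z)) := by
    have h := sq_sum_le_card_mul_sum_sq (s := (Finset.univ : Finset (S × Z)))
      (f := fun p => √(weightedForm ν (m p.1 p.2) (m p.1 p.2)))
    simp only [Real.sq_sqrt (hmnn _ _), Fintype.sum_prod_type, Finset.card_univ,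
      Fintype.card_prod, Nat.cast_mul] at h
    linarith
  rw [inv_mul_le_iff₀ hs0]
  refine (Finset.sum_le_sum fun s _ => Finset.sum_le_sum fun z _ => hnorm s z).trans ?_
  rw [← Real.sqrt_sq hs0.le, ← Real.sqrt_mul (sq_nonneg s₀)]
  apply Real.le_sqrt_of_sq_le
  calc _ ≤ s₀ * (N * ∑ s, ∑ z, weightedForm ν (m s z) (m s z)) := hcs
    _ ≤ s₀ * (s₀ * (N * ∑ x, weightedForm ν (τ x) (τ x) + (c - 1) * weightedForm ν w w)) := by
        gcongr
    _ ≤ s₀ * (s₀ * (N * (4 * μ) + (c - 1) * 2)) := by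
        have : 0 ≤ c - 1 := sub_nonneg.2 hc
        gcongr
    _ = _ := by ring

end LeftoverHash

/-! ### Smoothing and the state after hashing -/

section HashedStates

open Matrix

theorem cqState_posSemidef {X E : Type*} [Fintype X] [DecidableEq X] [Fintype E]
    {ρ : X → Matrix E E ℂ} (hρ : ∀ x, (ρ x).PosSemidef) :
    (cqState ρ).PosSemidef :=
  posSemidef_sum _ fun x _ => (posSemidef_single x).kronecker (hρ x)

theorem trace_cqState {X E : Type*} [Fintype X] [DecidableEq X] [Fintype E]
    (ρ : X → Matrix E E ℂ) : (cqState ρ).trace = ∑ x, (ρ x).trace := by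
  simp [trace_eq_sum_trace_diagBlock, diagBlock_cqState]

theorem posSemidef_of_cqState {X E : Type*} [Fintype X] [DecidableEq X]
    {ρ : X → Matrix E E ℂ} (h : (cqState ρ).PosSemidef) (x : X) :
    (ρ x).PosSemidef := by
  rw [← diagBlock_cqState ρ x]
  exact h.submatrix _

variable {S X Z E : Type*} [Fintype S] [DecidableEq S] [Fintype X] [DecidableEq X] [Fintype Z]
  [DecidableEq Z] [Fintype E] [DecidableEq E]

theorem traceNorm_cqState_le (ρ : X → Matrix E E ℂ) :
    traceNorm (cqState ρ) ≤ ∑ x, traceNorm (ρ x) := by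
  refine (traceNorm_sum_le _ _).trans (le_of_eq ?_)
  simp only [traceNorm_single_kronecker]

/-- The hashed state is classical on the hash value and on the seed. -/
theorem hashedState_eq_cqState {S X Z E : Type*} [Fintype S] [DecidableEq S] [Fintype X]
    [Fintype Z] [DecidableEq Z] (f : S → X → Z) (ρ : X → Matrix E E ℂ) :
    hashedState f ρ
      = cqState fun z => cqState fun s => (Fintype.card S : ℝ)⁻¹ • ∑ x with f s x = z, ρ x := by
  simp only [hashedState, cqState]
  refine Finset.sum_congr rfl fun z _ => ?_
  ext ⟨i, j⟩ ⟨i', j'⟩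
  simp only [Matrix.sum_apply, kroneckerMap_apply, ← Finset.mul_sum]
  congr 1
  refine Finset.sum_congr rfl fun s _ => ?_
  simp only [single_apply, Matrix.smul_apply, Complex.real_smul]
  split_ifs <;> simp [Matrix.sum_apply]

/-- The distance from uniform given the seed is at most the seed-averaged distance, for any state
`σ` of the side information that is uncorrelated with the seed. -/
theorem distUniform_hashedState_le {S X Z E : Type*} [Fintype S] [DecidableEq S] [Fintype X]
    [Fintype Z] [DecidableEq Z] [Fintype E] [DecidableEq E] [Nonempty S] (f : S → X → Z)
    (ρ : X → Matrix E E ℂ)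
    {σ : Matrix E E ℂ} (hσ : σ.PosSemidef) (htr : σ.trace = ∑ x, (ρ x).trace) :
    distUniform (hashedState f ρ) ≤ 1 / 2 * ((Fintype.card S : ℝ)⁻¹ * ∑ s, ∑ z,
      traceNorm (∑ x with f s x = z, ρ x - (Fintype.card Z : ℝ)⁻¹ • σ)) := by
  have hcard : (Fintype.card S : ℂ) ≠ 0 := by simp
  have hpt : (partialTraceA (hashedState f ρ)).trace = (hashedState f ρ).trace := by
    simp only [Matrix.trace, partialTraceA, Matrix.diag, Matrix.of_apply]
    rw [Finset.sum_comm, ← Fintype.sum_prod_type']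
  have htrace : (hashedState f ρ).trace = ∑ x, (ρ x).trace := by
    have hfib : ∀ s, ∑ z, ∑ x with f s x = z, (ρ x).trace = ∑ x, (ρ x).trace := fun s =>
      Finset.sum_fiberwise _ _ _
    rw [hashedState_eq_cqState]
    simp only [trace_cqState, Matrix.trace_smul, Matrix.trace_sum]
    rw [Finset.sum_comm]
    simp only [← Finset.smul_sum, hfib, Finset.sum_const, Finset.card_univ]
    simp [hcard]
  let σ' : Matrix (S × E) (S × E) ℂ := cqState fun _ => (Fintype.card S : ℝ)⁻¹ • σ
  have hσ' : σ'.PosSemidef ∧ σ'.trace = (partialTraceA (hashedState f ρ)).trace := by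
    refine ⟨cqState_posSemidef fun _ => hσ.smul (by positivity), ?_⟩
    rw [hpt, htrace, trace_cqState, ← htr]
    simp [hcard]
  refine (ciInf_le ⟨0, ?_⟩ ⟨σ', hσ'⟩).trans ?_
  · rintro _ ⟨y, rfl⟩
    exact mul_nonneg (by norm_num) (traceNorm_nonneg _)
  have e : hashedState f ρ - ((Fintype.card Z : ℂ)⁻¹ • (1 : Matrix Z Z ℂ)) ⊗ₖ σ'
      = cqState fun z => cqState fun s => (Fintype.card S : ℝ)⁻¹ •
        (∑ x with f s x = z, ρ x - (Fintype.card Z : ℝ)⁻¹ • σ) := by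
    rw [hashedState_eq_cqState]
    ext ⟨z, s, i⟩ ⟨z', s', i'⟩
    simp only [Matrix.sub_apply, kroneckerMap_apply, cqState_apply, σ', Matrix.smul_apply,
      Matrix.one_apply, Complex.real_smul, smul_eq_mul]
    split_ifs <;> simp [mul_sub]
    ring
  gcongr
  change traceNorm (hashedState f ρ - ((Fintype.card Z : ℂ)⁻¹ • (1 : Matrix Z Z ℂ)) ⊗ₖ σ') ≤ _
  rw [e, Finset.sum_comm, Finset.mul_sum]
  refine (traceNorm_cqState_le _).trans (Finset.sum_le_sum fun z _ => ?_)
  refine (traceNorm_cqState_le _).trans (le_of_eq ?_)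
  simp only [traceNorm_smul, abs_inv, Nat.abs_cast, Finset.mul_sum]

theorem distUniform_hashedState_le_trace [Nonempty S] [Nonempty Z] (f : S → X → Z)
    {ρ : X → Matrix E E ℂ} (hρ : (cqState ρ).PosSemidef) :
    distUniform (hashedState f ρ) ≤ (cqState ρ).trace.re := by
  have hx := posSemidef_of_cqState hρ
  have hsum : (∑ x, ρ x).PosSemidef := posSemidef_sum _ fun x _ => hx x
  refine (distUniform_hashedState_le f ρ hsum (trace_sum _ _)).trans ?_
  have hS : (0 : ℝ) < Fintype.card S := by simp [Fintype.card_pos]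
  have hZ : (Fintype.card Z : ℝ) ≠ 0 := by simp
  have hs : ∀ s, ∑ z, traceNorm (∑ x with f s x = z, ρ x - (Fintype.card Z : ℝ)⁻¹ • ∑ x, ρ x)
      ≤ 2 * (cqState ρ).trace.re := by
    intro s
    refine (Finset.sum_le_sum fun z _ => traceNorm_sub_le _ _).trans (le_of_eq ?_)
    have h1 : ∀ z, traceNorm (∑ x with f s x = z, ρ x) = ∑ x with f s x = z, (ρ x).trace.re := by
      intro z
      rw [traceNorm_of_posSemidef (posSemidef_sum _ fun x _ => hx x), trace_sum, Complex.re_sum]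
    simp only [Finset.sum_add_distrib, h1, traceNorm_smul, traceNorm_of_posSemidef hsum]
    rw [Finset.sum_fiberwise, trace_cqState, trace_sum, Complex.re_sum]
    simp [hZ]
    ring
  have := Finset.sum_le_sum fun s (_ : s ∈ Finset.univ) => hs s
  rw [Finset.sum_const, Finset.card_univ, nsmul_eq_mul, ← inv_mul_le_iff₀ hS] at this
  linarith

/-- The distance from uniform after hashing, in terms of a smoothing state. The state `τ` need not
be classical on `X`: it is pinched, which affects neither bound. -/
theorem distUniform_hashedState_le_of_mem_epsBall [Nonempty S] [Nonempty Z] (f : S → X → Z)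
    {c : ℝ} (hc : 1 ≤ c)
    (hf : ∀ x x', x ≠ x' → (Fintype.card Z : ℝ) *
      (Finset.univ.filter fun s => f s x = f s x').card ≤ c * Fintype.card S)
    {ε : ℝ} {ρ : X → Matrix E E ℂ} (hρ : IsSubnormalizedState (cqState ρ))
    {τ : Matrix (X × E) (X × E) ℂ} (hτ : τ ∈ epsBall ε (cqState ρ)) {σ : Matrix E E ℂ}
    (hσ : IsNormalizedState σ) {μ : ℝ} (hμ : 0 ≤ μ) (hle : τ ≤ μ • ((1 : Matrix X X ℂ) ⊗ₖ σ)) :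
    distUniform (hashedState f ρ)
      ≤ ε + 1 / 2 * √(4 * (Fintype.card Z * μ) + 2 * (c - 1)) := by
  obtain ⟨hτs, hP⟩ := hτ
  have hD := (generalizedTraceDist_le_purifiedDist hρ hτs).trans hP
  set T : X → Matrix E E ℂ := diagBlock τ with hT
  have hTpos : ∀ x, (T x).PosSemidef := fun x => hτs.1.submatrix _
  have hTle : ∀ x, T x ≤ μ • σ := by
    intro x
    rw [Matrix.le_iff]
    have h := (Matrix.le_iff.1 hle).submatrix (Prod.mk x)
    convert h using 1
    ext e e'
    simp [hT, diagBlock, kroneckerMap_apply]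
  set w := ∑ x, T x with hw
  have hwpos : w.PosSemidef := posSemidef_sum _ fun x _ => hTpos x
  have hwtr : w.trace = τ.trace := by
    rw [hw, trace_sum, trace_eq_sum_trace_diagBlock]
  have hwre : w.trace.re = τ.trace.re := by rw [hwtr]
  set t := (cqState ρ).trace.re with ht
  set s₀ := τ.trace.re with hs₀
  have hs0 : 0 < s₀ := hτs.2.1
  have ht0 : 0 < t := hρ.2.1
  have real_trace : ∀ {H : Type _} [Fintype H] {A : Matrix H H ℂ}, A.PosSemidef →
      A.trace = (A.trace.re : ℂ) := fun hA =>
    Complex.ext rfl (by simpa using (Complex.nonneg_iff.1 hA.trace_nonneg).2.symm)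
  have : Nonempty E := by
    by_contra hE
    rw [not_nonempty_iff] at hE
    have := hσ.2
    simp [Matrix.trace] at this
  have hS : (0 : ℝ) < Fintype.card S := by simp [Fintype.card_pos]
  have hZ : (Fintype.card Z : ℝ) ≠ 0 := by simp
  -- The marginal of the pinched state is rescaled to the trace of `ρ`. This costs the trace
  -- difference, which is part of the generalized trace distance.
  have hσ'tr : ((t / s₀) • w).trace = ∑ x, (ρ x).trace := by
    rw [← trace_cqState, real_trace hρ.1, trace_smul, hwtr, real_trace hτs.1, ← ht, ← hs₀,
      Complex.real_smul, ← Complex.ofReal_mul, div_mul_cancel₀ _ hs0.ne']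
  refine (distUniform_hashedState_le f ρ
    (hwpos.smul (by positivity : 0 ≤ t / s₀)) hσ'tr).trans ?_
  have hlhl := leftover_hash hTpos (by rw [← hw, hwre]; exact hτs.2.2) hσ hμ hTle f hc hf
  rw [← hw] at hlhl
  have hpinch : ∑ x, traceNorm (ρ x - T x) ≤ traceNorm (cqState ρ - τ) := by
    refine le_trans (le_of_eq ?_) (sum_traceNorm_diagBlock_le _)
    refine Finset.sum_congr rfl fun x _ => ?_
    congr 1
    rw [← diagBlock_cqState ρ x]
    rfl
  have hcorr : traceNorm (w - (t / s₀) • w) = |t - s₀| := by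
    have : w - (t / s₀) • w = (1 - t / s₀) • w := by module
    rw [this, traceNorm_smul, traceNorm_of_posSemidef hwpos, hwre, ← abs_of_pos hs0, ← abs_mul,
      abs_of_pos hs0, abs_sub_comm]
    congr 1
    field_simp
  have hs : ∀ s, ∑ z, traceNorm (∑ x with f s x = z, ρ x
        - (Fintype.card Z : ℝ)⁻¹ • (t / s₀) • w)
      ≤ traceNorm (cqState ρ - τ) + |t - s₀|
        + ∑ z, traceNorm (∑ x with f s x = z, T x - (Fintype.card Z : ℝ)⁻¹ • w) := by
    intro s
    have hz : ∀ z, traceNorm (∑ x with f s x = z, ρ x - (Fintype.card Z : ℝ)⁻¹ • (t / s₀) • w)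
        ≤ ∑ x with f s x = z, traceNorm (ρ x - T x) + (Fintype.card Z : ℝ)⁻¹ * |t - s₀|
          + traceNorm (∑ x with f s x = z, T x - (Fintype.card Z : ℝ)⁻¹ • w) := by
      intro z
      have : ∑ x with f s x = z, ρ x - (Fintype.card Z : ℝ)⁻¹ • (t / s₀) • w
          = (∑ x with f s x = z, (ρ x - T x)
            + (Fintype.card Z : ℝ)⁻¹ • (w - (t / s₀) • w))
            + (∑ x with f s x = z, T x - (Fintype.card Z : ℝ)⁻¹ • w) := by
        rw [Finset.sum_sub_distrib]
        module
      rw [this]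
      refine (traceNorm_add_le _ _).trans ?_
      gcongr
      refine (traceNorm_add_le _ _).trans ?_
      gcongr
      · exact traceNorm_sum_le _ _
      · rw [traceNorm_smul, hcorr, abs_inv, Nat.abs_cast]
    refine (Finset.sum_le_sum fun z _ => hz z).trans ?_
    rw [Finset.sum_add_distrib, Finset.sum_add_distrib, Finset.sum_fiberwise]
    gcongr
    simp [hZ]
  have hsum := Finset.sum_le_sum fun s (_ : s ∈ Finset.univ) => hs s
  rw [Finset.sum_add_distrib, Finset.sum_const, Finset.card_univ, nsmul_eq_mul] at hsum
  have hfin := mul_le_mul_of_nonneg_left hsum (inv_nonneg.2 hS.le)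
  rw [mul_add, inv_mul_cancel_left₀ hS.ne'] at hfin
  linarith

end HashedStates

/-! ### The error bound -/

section ErrorBound

open Matrix

theorem twoPow_mono : Monotone twoPow := fun _ _ h =>
  EReal.exp_monotone (mul_le_mul_of_nonneg_left h
    (by exact_mod_cast Real.log_nonneg one_le_two))

theorem twoPow_logb {g : ℝ} (hg : 0 < g) : twoPow (Real.logb 2 g : EReal) = ENNReal.ofReal g := by
  rw [twoPow, ← EReal.coe_mul, EReal.exp_coe, Real.logb,
    mul_div_cancel₀ _ (Real.log_pos one_lt_two).ne', Real.exp_log hg]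

theorem two_rpow_add_logb (a : ℝ) {C : ℝ} (hC : 0 < C) :
    (2 : ℝ) ^ (a + Real.logb 2 C) = 2 ^ a * C := by
  rw [Real.rpow_add two_pos, Real.rpow_logb two_pos (by norm_num) hC]

/-- It suffices to prove the error bound for each smoothing state and each real `l` that is
admissible for it, in place of the supremum of all of these. -/
theorem ofReal_le_of_forall_admissible {X E : Type*} [Fintype X] [DecidableEq X] [Fintype E]
    [DecidableEq E] {ρ : Matrix (X × E) (X × E) ℂ} {ε a C D d : ℝ} (hC : 0 < C)
    (h : ∀ τ ∈ epsBall ε ρ, ∀ σ : Matrix E E ℂ, IsNormalizedState σ → ∀ l : ℝ,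
      τ ≤ ((2 : ℝ) ^ (-l)) • ((1 : Matrix X X ℂ) ⊗ₖ σ) → d ≤ D + 1 / 2 * √(2 ^ (a - l) * C)) :
    ENNReal.ofReal d ≤ ENNReal.ofReal D + 1 / 2 *
      twoPow ((a : EReal) - smoothMinEntropy ε ρ + (Real.logb 2 C : EReal)) ^ (1 / 2 : ℝ) := by
  by_cases hd : d ≤ D
  · exact (ENNReal.ofReal_le_ofReal hd).trans le_self_add
  rw [not_le] at hd
  set g : ℝ := (2 * (d - D)) ^ 2 with hg
  have hg0 : 0 < g := by
    have : 0 < d - D := sub_pos.2 hd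
    positivity
  -- Every admissible `l`, and thus the smooth min-entropy, is at most the value at which the
  -- claimed bound equals `d`.
  have hH : smoothMinEntropy ε ρ ≤ ((a + Real.logb 2 C - Real.logb 2 g : ℝ) : EReal) := by
    refine iSup₂_le fun τ hτ => iSup₂_le fun σ hσ => iSup₂_le fun l hl => ?_
    rw [EReal.coe_le_coe_iff]
    have h1 : 2 * (d - D) ≤ √(2 ^ (a - l) * C) := by
      have := h τ hτ σ hσ l hl
      linarith
    have h2 : g ≤ 2 ^ (a - l + Real.logb 2 C) := by
      rw [two_rpow_add_logb _ hC]
      exact (Real.le_sqrt' (by linarith)).1 h1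
    have h3 := (Real.logb_le_iff_le_rpow one_lt_two hg0).2 h2
    linarith
  have hpow : ENNReal.ofReal g
      ≤ twoPow ((a : EReal) - smoothMinEntropy ε ρ + (Real.logb 2 C : EReal)) := by
    rw [← twoPow_logb hg0]
    apply twoPow_mono
    calc (Real.logb 2 g : EReal)
        = (a : EReal) - ((a + Real.logb 2 C - Real.logb 2 g : ℝ) : EReal)
          + (Real.logb 2 C : EReal) := by
          rw [← EReal.coe_sub, ← EReal.coe_add]
          congr 1
          ring
      _ ≤ _ := add_le_add_left (EReal.sub_le_sub le_rfl hH) _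
  calc ENNReal.ofReal d ≤ ENNReal.ofReal D + ENNReal.ofReal (d - D) := by
        have := ENNReal.ofReal_add_le (p := D) (q := d - D)
        rwa [add_sub_cancel] at this
    _ = ENNReal.ofReal D + 1 / 2 * ENNReal.ofReal g ^ (1 / 2 : ℝ) := by
        rw [ENNReal.ofReal_rpow_of_pos hg0, ← Real.sqrt_eq_rpow, hg,
          Real.sqrt_sq (by linarith), ENNReal.ofReal_mul zero_le_two, ENNReal.ofReal_ofNat,
          ← mul_assoc, one_div, ENNReal.inv_mul_cancel two_ne_zero ENNReal.ofNat_ne_top, one_mul]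
    _ ≤ _ := by gcongr

variable {S : Type*} [Fintype S] [DecidableEq S] {n ℓ : ℕ}

theorem card_bitString (m : ℕ) : (Fintype.card (BitString m) : ℝ) = 2 ^ m := by
  simp [BitString]

theorem two_pow_mul_rpow_neg (ℓ : ℕ) (l : ℝ) : (2 : ℝ) ^ ℓ * 2 ^ (-l) = 2 ^ ((ℓ : ℝ) - l) := by
  rw [sub_eq_add_neg, Real.rpow_add two_pos, Real.rpow_natCast]

/-- For large errors, or for hash values no shorter than the input, the bound holds for every
function: the distance from uniform is at most `tr ρ`, and for an `n`-bit string `X` the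
min-entropy of a smoothing state `τ` is at most `n - log₂ (tr τ)`. -/
theorem satisfiesErrorBound_of_trivial [Nonempty S] (f : S → BitString n → BitString ℓ) {ε : ℝ}
    (hε : 0 < ε) (h : 1 ≤ 3 * ε ∨ n ≤ ℓ) : SatisfiesErrorBound.{u} f ε := by
  intro E _ _ ρ hρ
  have htriv := distUniform_hashedState_le_trace f hρ.1
  by_cases hε3 : 1 ≤ 3 * ε
  · exact (ENNReal.ofReal_le_ofReal (by linarith [hρ.2.2])).trans le_self_add
  have hnℓ : n ≤ ℓ := h.resolve_left hε3
  refine ofReal_le_of_forall_admissible (a := ℓ) (by positivity) fun τ hτ σ hσ l hl => ?_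
  have hD := (generalizedTraceDist_le_purifiedDist hρ hτ.1).trans hτ.2
  have h1 := traceNorm_nonneg (cqState ρ - τ)
  have h2 := le_abs_self ((cqState ρ).trace.re - τ.trace.re)
  have hτ0 := hτ.1.2.1
  have hτ1 := hτ.1.2.2
  have htr : τ.trace.re ≤ 2 ^ ((ℓ : ℝ) - l) := by
    have h3 := (Complex.nonneg_iff.1 (Matrix.le_iff.1 hl).trace_nonneg).1
    rw [trace_sub, trace_smul, trace_kronecker, hσ.2, mul_one, trace_one, Complex.sub_re,
      Complex.smul_re, Complex.natCast_re, card_bitString, smul_eq_mul] at h3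
    calc τ.trace.re ≤ 2 ^ n * 2 ^ (-l) := by linarith
      _ ≤ 2 ^ ℓ * 2 ^ (-l) := by
          have : (2 : ℝ) ^ n ≤ 2 ^ ℓ := pow_le_pow_right₀ one_le_two hnℓ
          gcongr
      _ = _ := two_pow_mul_rpow_neg ℓ l
  have hC : 4 ≤ 2 / ε ^ 2 + 1 := by
    have : 3 ≤ 2 / ε ^ 2 := by
      rw [le_div_iff₀ (by positivity)]
      nlinarith
    linarith
  -- `tr τ ≤ √(tr τ)`, as `tr τ ≤ 1`
  have hsq : 2 * τ.trace.re ≤ √(2 ^ ((ℓ : ℝ) - l) * (2 / ε ^ 2 + 1)) := by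
    apply Real.le_sqrt_of_sq_le
    nlinarith
  linarith

/-- Almost two-universal hashing satisfies the error bound. -/
theorem satisfiesErrorBound_of_collision_bound [Nonempty S] (f : S → BitString n → BitString ℓ)
    {ε : ℝ} (hε : 0 < ε) (hε3 : 3 * ε ≤ 1)
    (hf : ∀ x x', x ≠ x' → (2 : ℝ) ^ ℓ * (Finset.univ.filter fun s => f s x = f s x').card
      ≤ (1 + 4 * ε ^ 2) * Fintype.card S) : SatisfiesErrorBound.{u} f ε := by
  intro E _ _ ρ hρ
  refine ofReal_le_of_forall_admissible (a := ℓ) (by positivity) fun τ hτ σ hσ l hl => ?_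
  refine (distUniform_hashedState_le_of_mem_epsBall f (c := 1 + 4 * ε ^ 2)
    (le_add_of_nonneg_right (by positivity)) (by rwa [card_bitString]) hρ hτ hσ
    (Real.rpow_nonneg zero_le_two _) hl).trans ?_
  rw [card_bitString, two_pow_mul_rpow_neg]
  set y : ℝ := 2 ^ ((ℓ : ℝ) - l)
  have hy : 0 ≤ y := Real.rpow_nonneg zero_le_two _
  have hC : 4 ≤ 2 / ε ^ 2 + 1 := by
    have : 3 ≤ 2 / ε ^ 2 := by
      rw [le_div_iff₀ (by positivity)]
      nlinarith
    linarith
  -- `√(4 y + 8 ε²) ≤ √(4 y) + √8 ε`, and `√8 ≤ 4`.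
  have h1 : √(4 * y + 2 * (1 + 4 * ε ^ 2 - 1)) ≤ √(y * (2 / ε ^ 2 + 1)) + 4 * ε := by
    rw [Real.sqrt_le_left (by positivity)]
    have := Real.sq_sqrt (show 0 ≤ y * (2 / ε ^ 2 + 1) by positivity)
    have h0 := Real.sqrt_nonneg (y * (2 / ε ^ 2 + 1))
    nlinarith [mul_nonneg h0 hε.le]
  linarith

end ErrorBound

theorem theorem4 (n ℓ : ℕ) (hn : 0 < n) (hℓ : 0 < ℓ) (ε : ℝ) (hε : 0 < ε) (k : ℕ)
    (hk : (k : ℤ) = ⌊(ℓ : ℝ) + Real.logb 2 ((n : ℝ) / ℓ) + Real.logb 2 (1 / ε ^ 2) - 1⌋) :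
    (∃ f : BitString (2 * k) → BitString n → BitString ℓ,
      seedLength f =
        2 * ⌊(ℓ : ℝ) + Real.logb 2 ((n : ℝ) / ℓ) + Real.logb 2 (1 / ε ^ 2) - 1⌋ ∧
      SatisfiesErrorBound.{u} f ε) ∧
    (∀ b : Module.Basis (Fin k) (ZMod 2) (GaloisField 2 k),
      seedLength (composedHash b n ℓ) =
        2 * ⌊(ℓ : ℝ) + Real.logb 2 ((n : ℝ) / ℓ) + Real.logb 2 (1 / ε ^ 2) - 1⌋ ∧
      SatisfiesErrorBound.{u} (composedHash b n ℓ) ε) := by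
  have hcard : Fintype.card (BitString (2 * k))
      = Fintype.card (BitString k × BitString k) := by
    simp [BitString, two_mul, pow_add]
  have hlen : Real.logb 2 (Fintype.card (BitString (2 * k))) = 2 * ((k : ℤ) : ℝ) := by
    rw [card_bitString, Real.logb_pow, Real.logb_self_eq_one one_lt_two]
    push_cast
    ring
  simp only [seedLength, ← hcard, ← hk]
  have hnR : (0 : ℝ) < n := by exact_mod_cast hn
  have hℓR : (0 : ℝ) < ℓ := by exact_mod_cast hℓ
  by_cases htriv : 1 ≤ 3 * ε ∨ n ≤ ℓ
  · exact ⟨⟨fun _ _ => 0, hlen, satisfiesErrorBound_of_trivial _ hε htriv⟩,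
      fun b => ⟨hlen, satisfiesErrorBound_of_trivial _ hε htriv⟩⟩
  rw [not_or, not_le, not_le] at htriv
  obtain ⟨hε3, hℓn⟩ := htriv
  have hℓk : ℓ ≤ k := by
    have h1 : 0 ≤ Real.logb 2 ((n : ℝ) / ℓ) := by
      refine Real.logb_nonneg one_lt_two ?_
      rw [one_le_div hℓR]
      exact_mod_cast hℓn.le
    have h2 : 1 ≤ Real.logb 2 (1 / ε ^ 2) := by
      rw [Real.le_logb_iff_rpow_le one_lt_two (by positivity), Real.rpow_one,
        le_div_iff₀ (by positivity)]
      nlinarith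
    have h3 : (ℓ : ℤ) ≤ k := by
      rw [hk, Int.le_floor]
      push_cast
      linarith
    exact_mod_cast h3
  -- The floor in the definition of `k` costs a factor of `2`, and the `-1` another one.
  have hkε : (2 : ℝ) ^ ℓ * (n / ℓ) ≤ 4 * ε ^ 2 * 2 ^ k := by
    have h1 := Int.lt_floor_add_one
      ((ℓ : ℝ) + Real.logb 2 ((n : ℝ) / ℓ) + Real.logb 2 (1 / ε ^ 2) - 1)
    rw [← hk, Int.cast_natCast] at h1
    have h2 : (2 : ℝ) ^ ((ℓ : ℝ) + Real.logb 2 ((n : ℝ) / ℓ) + Real.logb 2 (1 / ε ^ 2))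
        ≤ 2 ^ ((k : ℝ) + 2) := Real.rpow_le_rpow_of_exponent_le one_le_two (by linarith)
    rw [two_rpow_add_logb _ (by positivity), two_rpow_add_logb _ (by positivity),
      Real.rpow_add two_pos, Real.rpow_natCast, Real.rpow_natCast, mul_one_div,
      div_le_iff₀ (by positivity)] at h2
    calc _ ≤ _ := h2
      _ = _ := by norm_num; ring
  have hcoll := fun (b : Module.Basis (Fin k) (ZMod 2) (GaloisField 2 k)) {x x' : BitString n}
    (hx : x ≠ x') => composedHash_collision_bound hℓ hℓk hkε b hx
  refine ⟨?_, fun b => ⟨hlen, satisfiesErrorBound_of_collision_bound _ hε hε3.le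
    fun x x' hx => hcoll b hx⟩⟩
  have hk0 : k ≠ 0 := (hℓ.trans_le hℓk).ne'
  let b := Module.finBasisOfFinrankEq (ZMod 2) (GaloisField 2 k) (GaloisField.finrank 2 hk0)
  let e : BitString (2 * k) ≃ BitString k × BitString k := Fintype.equivOfCardEq hcard
  refine ⟨fun s => composedHash b n ℓ (e s), hlen,
    satisfiesErrorBound_of_collision_bound _ hε hε3.le fun x x' hx => ?_⟩
  rw [hcard]
  refine le_trans (le_of_eq ?_) (hcoll b hx)
  congr 2
  exact Finset.card_equiv e (by simp)
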